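/- Let $p$ be a prime and $R$ a commutative ring with $pR=0$. Let $R^{(1)}$ be the group $R$ with the $R$-module structure $r\cdot r'=r^pr'$, regarded as an $R$-bimodule with equal left and right actions; for a finitely generated projective $R$-module $V$ put $V^{(1)}=R^{(1)}\otimes_RV$ and $\mathrm{Fr}:V\to V^{(1)}$, $v\mapsto 1\otimes v$. Let $\sigma$ be the cyclic permutation of order $p$ of $V^{\otimes_R p}$, let $\mathrm{tr}=1+\sigma+\dots+\sigma^{p-1}:(V^{\otimes p})_\sigma\to(V^{\otimes p})^\sigma$, let $\psi:V^{(1)}\to(V^{\otimes p})_\sigma$ be $r\otimes v\mapsto r[v^{\otimes p}]$, and let $\widehat\psi:(V^{\otimes p})^\sigma\to V^{(1)}$ be the transpose of the map $\psi$ for the dual module $V^*$. On $(V^{\otimes p})_\sigma$ and $(V^{\otimes p})^\sigma$ let $R$ act through the Frobenius map $r\mapsto r^p$, and set $$C_1(V)=(V^{\otimes p})_\sigma,\qquad C_0(V)=(V^{\otimes p})^\sigma\times_{V^{(1)}}V$$ (fibre product over $\widehat\psi$ and $\mathrm{Fr}$), $b=\psi$, $d(x)=(\mathrm{tr}\,x,0)$,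 $a(x,v)=v$. Then: (1) $C_0$ and $C_1$ are functors of $V$ that send $0$ to $0$, and $$0\to V^{(1)}\xrightarrow{\ b\ }C_1(V)\xrightarrow{\ d\ }C_0(V)\xrightarrow{\ a\ }V\to0$$ is exact and functorial in $V$; that is, $\langle C_\bullet,a,b\rangle$ is an elementary extension $\phi$ of $R$ by $R^{(1)}$. (2) The square-zero extension of $R$ by $R^{(1)}$ corresponding to $\phi$ is isomorphic to the ring $W_2(R)$ of second Witt vectors. In detail: $W_2(R)$, with $R^{(1)}\to W_2(R)$, $x\mapsto(0,x)$, and $W_2(R)\to R$, $(x_0,x_1)\mapsto x_0$, is a square-zero extension of $R$ by $R^{(1)}$. There is a splitting of $\phi$ over abelian groups, that is, a functor $C_{01}$ from finitely generated projective $R$-modules to abelian groups, with $C_{01}(0)=0$, and natural additive maps $c_1:C_1\to C_{01}$, $c_0:C_{01}\to C_0$ with $c_0c_1=d$, $c_1$ injective, $c_0$ surjective and $c_0^{-1}(\mathrm{Im}\,d)=\mathrm{Im}\,c_1$. For every such splitting let $R'$ be the ring of those natural additive endomorphisms $r'$ of $C_{01}$ for which there is $r\in R$ with $r'c_1=c_1r$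 and $c_0r'=rc_0$. There is a ring homomorphism $q:R'\to R$ such that $r=q(r')$ satisfies these two equations for every $r'\in R'$; with it and the map $i:R^{(1)}\to R'$, $i(m)=c_1\circ b\circ(m\otimes-)\circ a\circ c_0$, the ring $R'$ is a square-zero extension of $R$ by $R^{(1)}$, and there is a ring isomorphism $R'\cong W_2(R)$ that is compatible with the maps from $R^{(1)}$ and the maps to $R$. -/

import Mathlib

open CategoryTheory TensorProduct

namespace CyclicPower

universe u v w

/-! ### Finitely generated projective modules and pointed functors -/

section Functors

/-- The category `R-proj` of finitely generated projective `R`-modules. -/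
abbrev RProj (R : Type u) [CommRing R] :=
  ObjectProperty.FullSubcategory
    (fun V : ModuleCat.{u} R => Module.Finite R V ∧ Module.Projective R V)

/-- The functor `I : R-proj ⥤ R-mod`, the tautological embedding. -/
abbrev idFunctor (R : Type u) [CommRing R] : RProj R ⥤ ModuleCat.{u} R :=
  ObjectProperty.ι _

/-- The functor `I(M) : V ↦ M ⊗_R V` from `R-proj` to `R-mod`, for a diagonal `R`-bimodule `M`
(that is, an `R`-module `M` over the commutative ring `R`, acting in the same way on both sides). -/
noncomputable def tensorFunctor (R : Type u) [CommRing R] (M : Type u) [AddCommGroup M]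
    [Module R M] : RProj R ⥤ ModuleCat.{u} R where
  obj V := ModuleCat.of R (M ⊗[R] V.obj)
  map f := ModuleCat.ofHom (LinearMap.lTensor M f.hom.hom)
  map_id V := by
    ext : 1
    exact LinearMap.lTensor_id M V.obj
  map_comp f g := by
    ext : 1
    exact LinearMap.lTensor_comp M g.hom.hom f.hom.hom

/-- A functor on `R-proj` is pointed if it sends zero objects to zero objects. -/
def IsPointed {R : Type u} [CommRing R] {D : Type v} [Category.{w} D] (F : RProj R ⥤ D) : Prop :=
  ∀ V : RProj R, Limits.IsZero V → Limits.IsZero (F.obj V)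

/-- The forgetful functor `e_*` from `R`-modules to abelian groups. -/
abbrev forgetAb (R : Type u) [CommRing R] : ModuleCat.{u} R ⥤ AddCommGrpCat.{u} :=
  forget₂ (ModuleCat.{u} R) AddCommGrpCat.{u}

/-- The natural transformation `I ⟶ I(M)`, `v ↦ m ⊗ v`, attached to `m : M`. -/
noncomputable def tmulLeft (R : Type u) [CommRing R] {M : Type u} [AddCommGroup M]
    [Module R M] (m : M) : idFunctor R ⟶ tensorFunctor R M where
  app V := ModuleCat.ofHom (TensorProduct.mk R M V.obj m)
  naturality V W f := by
    ext v
    rfl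

end Functors

/-! ### Elementary extensions and their splittings -/

section Extensions

/-- The data of a sequence `0 ⟶ I(M) --b--> C₁ --d--> C₀ --a--> I ⟶ 0` of functors
`R-proj ⥤ R-mod` with zero composites. -/
structure FourTerm (R : Type u) [CommRing R] (M : Type u) [AddCommGroup M] [Module R M] where
  C₁ : RProj R ⥤ ModuleCat.{u} R
  C₀ : RProj R ⥤ ModuleCat.{u} R
  b : tensorFunctor R M ⟶ C₁
  d : C₁ ⟶ C₀
  a : C₀ ⟶ idFunctor R
  b_d : b ≫ d = 0
  d_a : d ≫ a = 0

/-- The sequence is an elementary extension of `R` by `M`: `C₁`, `C₀` are pointed functors and the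
four-term sequence is exact (exactness in a category of functors is checked objectwise). -/
structure FourTerm.IsElementaryExtension {R : Type u} [CommRing R] {M : Type u} [AddCommGroup M]
    [Module R M] (φ : FourTerm R M) : Prop where
  pointed₁ : IsPointed φ.C₁
  pointed₀ : IsPointed φ.C₀
  injective_b : ∀ V, Function.Injective (φ.b.app V).hom
  exact_b_d : ∀ V, Function.Exact (φ.b.app V).hom (φ.d.app V).hom
  exact_d_a : ∀ V, Function.Exact (φ.d.app V).hom (φ.a.app V).hom
  surjective_a : ∀ V, Function.Surjective (φ.a.app V).hom

/-- A splitting of the elementary extension `e_*(φ)` of functors from `R-proj` to abelian groups: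
a pointed functor `C₀₁` with maps `c₁ : C₁ ⟶ C₀₁` and `c₀ : C₀₁ ⟶ C₀` such that `c₀ ∘ c₁ = d`, the
square formed by `C₁ ⟶ C₀₁`, `Im d ⟶ C₀` is cartesian, and `c₀` is surjective. Equivalently, `C₀₁`
is filtered with `W₁ = C₁` and `C₀₁ / W₀ = C₀`, where `W₀ = I(M) ⊆ C₁`. -/
structure Splitting {R : Type u} [CommRing R] {M : Type u} [AddCommGroup M] [Module R M]
    (φ : FourTerm R M) where
  C₀₁ : RProj R ⥤ AddCommGrpCat.{u}
  pointed : IsPointed C₀₁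
  c₁ : φ.C₁ ⋙ forgetAb R ⟶ C₀₁
  c₀ : C₀₁ ⟶ φ.C₀ ⋙ forgetAb R
  comm : c₁ ≫ c₀ = Functor.whiskerRight φ.d (forgetAb R)
  injective_c₁ : ∀ V, Function.Injective (c₁.app V).hom
  cartesian : ∀ (V : RProj R) (x : C₀₁.obj V),
    (∃ y : φ.C₁.obj V, (c₀.app V).hom x = (φ.d.app V).hom y) → ∃ y, (c₁.app V).hom y = x
  surjective_c₀ : ∀ V, Function.Surjective (c₀.app V).hom

namespace Splitting

variable {R : Type u} [CommRing R] {M : Type u} [AddCommGroup M] [Module R M] {φ : FourTerm R M}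

/-- The endomorphism `f` of `C₀₁` is compatible, via `c₁` and `c₀`, with the multiplication by
`r` on `C₁` and on `C₀`. -/
def IsRegularWith (S : Splitting φ) (r : R) (f : End S.C₀₁) : Prop :=
  S.c₁ ≫ (show S.C₀₁ ⟶ S.C₀₁ from f) =
      Functor.whiskerRight (r • 𝟙 φ.C₁) (forgetAb R) ≫ S.c₁ ∧
    (show S.C₀₁ ⟶ S.C₀₁ from f) ≫ S.c₀ =
      S.c₀ ≫ Functor.whiskerRight (r • 𝟙 φ.C₀) (forgetAb R)

/-- The ring `R'` of regular endomorphisms of `C₀₁`: those compatible with the multiplication by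
some element `r : R`. -/
def regularEnd (S : Splitting φ) : Subring (End S.C₀₁) where
  carrier := {f | ∃ r : R, S.IsRegularWith r f}
  mul_mem' := by
    rintro f g ⟨r, hr₁, hr₀⟩ ⟨s, hs₁, hs₀⟩
    refine ⟨r * s, ?_, ?_⟩
    · have h : (r * s) • 𝟙 φ.C₁ = (s • 𝟙 φ.C₁) ≫ (r • 𝟙 φ.C₁) := by
        simp [smul_smul]
      rw [h, Functor.whiskerRight_comp, Category.assoc, ← hr₁, ← Category.assoc, ← hs₁,
        Category.assoc]
      rfl
    · have h : (r * s) • 𝟙 φ.C₀ = (s • 𝟙 φ.C₀) ≫ (r • 𝟙 φ.C₀) := by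
        simp [smul_smul]
      rw [h, Functor.whiskerRight_comp, ← Category.assoc, ← hs₀, Category.assoc, ← hr₀,
        ← Category.assoc]
      rfl
  one_mem' := by
    refine ⟨1, ?_, ?_⟩
    · rw [one_smul, Functor.whiskerRight_id']
      exact (Category.comp_id _).trans (Category.id_comp _).symm
    · rw [one_smul, Functor.whiskerRight_id']
      exact (Category.id_comp _).trans (Category.comp_id _).symm
  add_mem' := by
    rintro f g ⟨r, hr₁, hr₀⟩ ⟨s, hs₁, hs₀⟩
    refine ⟨r + s, ?_, ?_⟩
    · have h : Functor.whiskerRight ((r + s) • 𝟙 φ.C₁) (forgetAb R) =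
          Functor.whiskerRight (r • 𝟙 φ.C₁) (forgetAb R) +
            Functor.whiskerRight (s • 𝟙 φ.C₁) (forgetAb R) := by
        rw [add_smul]; rfl
      rw [h, Preadditive.add_comp, ← hr₁, ← hs₁]
      exact Preadditive.comp_add _ _ _ S.c₁ f g
    · have h : Functor.whiskerRight ((r + s) • 𝟙 φ.C₀) (forgetAb R) =
          Functor.whiskerRight (r • 𝟙 φ.C₀) (forgetAb R) +
            Functor.whiskerRight (s • 𝟙 φ.C₀) (forgetAb R) := by
        rw [add_smul]; rfl
      rw [h, Preadditive.comp_add, ← hr₀, ← hs₀]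
      exact Preadditive.add_comp _ _ _ f g S.c₀
  zero_mem' := by
    refine ⟨0, ?_, ?_⟩
    · have h : Functor.whiskerRight ((0 : R) • 𝟙 φ.C₁) (forgetAb R) = 0 := by
        rw [zero_smul]; rfl
      rw [h, Limits.zero_comp]
      exact Limits.comp_zero
    · have h : Functor.whiskerRight ((0 : R) • 𝟙 φ.C₀) (forgetAb R) = 0 := by
        rw [zero_smul]; rfl
      rw [h, Limits.comp_zero]
      exact Limits.zero_comp
  neg_mem' := by
    rintro f ⟨r, hr₁, hr₀⟩
    refine ⟨-r, ?_, ?_⟩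
    · have h : Functor.whiskerRight ((-r) • 𝟙 φ.C₁) (forgetAb R) =
          -Functor.whiskerRight (r • 𝟙 φ.C₁) (forgetAb R) := by
        rw [neg_smul]; rfl
      rw [h, Preadditive.neg_comp, ← hr₁]
      exact Preadditive.comp_neg _ _
    · have h : Functor.whiskerRight ((-r) • 𝟙 φ.C₀) (forgetAb R) =
          -Functor.whiskerRight (r • 𝟙 φ.C₀) (forgetAb R) := by
        rw [neg_smul]; rfl
      rw [h, Preadditive.comp_neg, ← hr₀]
      exact Preadditive.neg_comp _ _

/-- The endomorphism of `C₀₁` attached to `m : M`, namely the composite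
`C₀₁ --c₀--> C₀ --a--> I --(v ↦ m ⊗ v)--> I(M) --b--> C₁ --c₁--> C₀₁`. -/
noncomputable def inclEnd (S : Splitting φ) (m : M) : End S.C₀₁ :=
  S.c₀ ≫ Functor.whiskerRight (φ.a ≫ tmulLeft R m ≫ φ.b) (forgetAb R) ≫ S.c₁

theorem inclEnd_isRegularWith (S : Splitting φ) (m : M) :
    S.IsRegularWith 0 (S.inclEnd m) := by
  constructor
  · have h : Functor.whiskerRight ((0 : R) • 𝟙 φ.C₁) (forgetAb R) = 0 := by
      rw [zero_smul]; rfl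
    have h' : Functor.whiskerRight (φ.d ≫ φ.a ≫ tmulLeft R m ≫ φ.b) (forgetAb R) = 0 := by
      rw [reassoc_of% φ.d_a, Limits.zero_comp]; rfl
    rw [Functor.whiskerRight_comp, ← S.comm, Category.assoc] at h'
    have h'' := congrArg (fun t => t ≫ S.c₁) h'
    simp only [Category.assoc, Limits.zero_comp] at h''
    rw [h, Limits.zero_comp]
    exact h''
  · have h : Functor.whiskerRight ((0 : R) • 𝟙 φ.C₀) (forgetAb R) = 0 := by
      rw [zero_smul]; rfl
    have h' : Functor.whiskerRight (φ.a ≫ tmulLeft R m ≫ φ.b ≫ φ.d) (forgetAb R) = 0 := by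
      rw [φ.b_d, Limits.comp_zero, Limits.comp_zero]; rfl
    rw [← Category.assoc (tmulLeft R m), ← Category.assoc φ.a, Functor.whiskerRight_comp,
      ← S.comm] at h'
    have h'' := congrArg (fun t => S.c₀ ≫ t) h'
    simp only [Limits.comp_zero] at h''
    rw [h, Limits.comp_zero]
    dsimp only [inclEnd]
    simp only [Category.assoc]
    exact h''

/-- The map `M → R'`, `m ↦ c₁ ∘ b ∘ (m ⊗ -) ∘ a ∘ c₀`. -/
noncomputable def incl (S : Splitting φ) : M →+ S.regularEnd where
  toFun m := ⟨S.inclEnd m, 0, S.inclEnd_isRegularWith m⟩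
  map_zero' := by
    refine Subtype.ext ?_
    have h : Functor.whiskerRight (φ.a ≫ tmulLeft R (0 : M) ≫ φ.b) (forgetAb R) = 0 := by
      have h0 : tmulLeft R (0 : M) = 0 := by
        ext V v
        exact TensorProduct.zero_tmul M v
      rw [h0, Limits.zero_comp, Limits.comp_zero]; rfl
    change S.c₀ ≫ _ ≫ S.c₁ = 0
    rw [h, Limits.zero_comp, Limits.comp_zero]
  map_add' m m' := by
    refine Subtype.ext ?_
    have h : Functor.whiskerRight (φ.a ≫ tmulLeft R (m + m') ≫ φ.b) (forgetAb R) =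
        Functor.whiskerRight (φ.a ≫ tmulLeft R m ≫ φ.b) (forgetAb R) +
          Functor.whiskerRight (φ.a ≫ tmulLeft R m' ≫ φ.b) (forgetAb R) := by
      have h0 : tmulLeft R (m + m') = tmulLeft R m + tmulLeft R m' := by
        ext V v
        exact TensorProduct.add_tmul m m' v
      rw [h0, Preadditive.add_comp, Preadditive.comp_add]; rfl
    change S.c₀ ≫ _ ≫ S.c₁ = S.c₀ ≫ _ ≫ S.c₁ + S.c₀ ≫ _ ≫ S.c₁
    rw [h, Preadditive.add_comp, Preadditive.comp_add]

end Splitting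

/-- The maps `i : M → A` and `q : A → R` make the ring `A` a square-zero extension of the
commutative ring `R` by the diagonal bimodule `M`. -/
structure IsSquareZeroExtension {R : Type u} [CommRing R] {M : Type v} [AddCommGroup M]
    [Module R M] {A : Type w} [Ring A] (i : M →+ A) (q : A →+* R) : Prop where
  injective : Function.Injective i
  exact : Function.Exact i q
  surjective : Function.Surjective q
  right_mul : ∀ (m : M) (x : A), i m * x = i (q x • m)
  left_mul : ∀ (m : M) (x : A), x * i m = i (q x • m)
  sq_zero : ∀ m m' : M, i m * i m' = 0

end Extensions

/-! ### The Frobenius twist -/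

section Twist

variable {p : ℕ} [Fact p.Prime] {R : Type u} [CommRing R]

/-- The Frobenius endomorphism `r ↦ r ^ p` of a commutative ring annihilated by the prime `p`
(the zero ring is allowed). -/
def frob (hR : (p : R) = 0) : R →+* R where
  toFun r := r ^ p
  map_one' := one_pow p
  map_mul' r s := mul_pow r s p
  map_zero' := zero_pow (Fact.out : p.Prime).ne_zero
  map_add' r s := by
    obtain ⟨t, ht⟩ := exists_add_pow_prime_eq (Fact.out : p.Prime) r s
    rw [ht, hR]
    ring

/-- The `R`-module obtained from an `R`-module `X` by restriction of scalars along the Frobenius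
map: the group `X` with `r • x = r ^ p * x`. In particular `Twist hR R` is the module `R^{(1)}`. -/
def Twist (_hR : (p : R) = 0) (X : Type u) : Type u := X

instance (hR : (p : R) = 0) (X : Type u) [AddCommGroup X] : AddCommGroup (Twist hR X) :=
  inferInstanceAs (AddCommGroup X)

instance (hR : (p : R) = 0) (X : Type u) [AddCommGroup X] [Module R X] : Module R (Twist hR X) :=
  Module.compHom X (frob hR)

/-- The identity map of `X`, as an additive map to the twist. -/
def toTwist (hR : (p : R) = 0) (X : Type u) [AddCommGroup X] : X ≃+ Twist hR X :=
  AddEquiv.refl X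

theorem smul_toTwist (hR : (p : R) = 0) {X : Type u} [AddCommGroup X] [Module R X] (r : R)
    (x : X) : r • toTwist hR X x = toTwist hR X (r ^ p • x) := rfl

/-- An `R`-linear map remains linear between the twists. -/
def twistMap (hR : (p : R) = 0) {X Y : Type u} [AddCommGroup X] [Module R X] [AddCommGroup Y]
    [Module R Y] (f : X →ₗ[R] Y) : Twist hR X →ₗ[R] Twist hR Y where
  toFun x := toTwist hR Y (f ((toTwist hR X).symm x))
  map_add' x y := by simp
  map_smul' r x := f.map_smul (r ^ p) x

end Twist

/-! ### Cyclic powers -/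

section Cyclic

/-- A rotation-invariant function on subsets of `Fin p`, with values in a group annihilated by
`p`, sums to the sum of its values at the two fixed points. -/
theorem sum_rotation {p : ℕ} [Fact p.Prime] {A : Type*} [AddCommGroup A]
    (hA : ∀ x : A, p • x = 0) (g : Finset (Fin p) → A)
    (hg : ∀ S, g (S.map (finRotate p).toEmbedding) = g S) :
    ∑ S : Finset (Fin p), g S = g ∅ + g Finset.univ := by
  have hp : p.Prime := Fact.out
  have key : ∀ k, 0 < k → k < p →
      ∑ S ∈ Finset.powersetCard k (Finset.univ : Finset (Fin p)), g S = 0 := by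
    intro k hk0 hkp
    set T := ∑ S ∈ Finset.powersetCard k (Finset.univ : Finset (Fin p)), g S with hT
    let N : Fin p → A := fun i =>
      ∑ S ∈ Finset.powersetCard k (Finset.univ : Finset (Fin p)), if i ∈ S then g S else 0
    have h1 : k • T = ∑ i, N i := by
      rw [hT, Finset.smul_sum, Finset.sum_comm]
      refine Finset.sum_congr rfl fun S hS => ?_
      rw [← Finset.sum_filter, Finset.sum_const]
      congr 1
      rw [Finset.filter_mem_eq_inter, Finset.univ_inter]
      exact (Finset.mem_powersetCard.1 hS).2.symm
    have h2 : ∀ i, N (finRotate p i) = N i := by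
      intro i
      refine (Finset.sum_bij (fun S _ => S.map (finRotate p).toEmbedding) ?_ ?_ ?_ ?_).symm
      · intro S hS
        rw [Finset.mem_powersetCard] at hS ⊢
        exact ⟨Finset.subset_univ _, by rw [Finset.card_map]; exact hS.2⟩
      · intro S _ S' _ h
        exact Finset.map_injective _ h
      · intro S hS
        refine ⟨S.map (finRotate p).symm.toEmbedding, ?_, ?_⟩
        · rw [Finset.mem_powersetCard] at hS ⊢
          exact ⟨Finset.subset_univ _, by rw [Finset.card_map]; exact hS.2⟩
        · ext j
          simp
      · intro S _
        rw [hg]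
        simp
    have : NeZero p := ⟨hp.ne_zero⟩
    have h3 : ∀ n : ℕ, N (Fin.ofNat p n) = N 0 := by
      intro n
      induction n with
      | zero => rfl
      | succ n ih =>
        rw [← ih, ← h2 (Fin.ofNat p n), finRotate_apply]
        congr 1
        ext
        simp [Fin.val_add]
    have h4 : ∀ i, N i = N 0 := fun i => by
      have := h3 i.val
      rwa [Fin.ofNat_val_eq_self] at this
    have h5 : k • T = 0 := by
      rw [h1, Finset.sum_congr rfl fun i _ => h4 i, Finset.sum_const, Finset.card_univ,
        Fintype.card_fin, hA]
    have h6 : IsCoprime (k : ℤ) (p : ℤ) :=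
      Nat.isCoprime_iff_coprime.2 (Nat.Coprime.symm
      ((Nat.Prime.coprime_iff_not_dvd hp).2 fun h => absurd (Nat.le_of_dvd hk0 h) (by omega)))
    obtain ⟨a, b, hab⟩ := h6
    calc T = (a * k + b * p) • T := by rw [hab, one_smul]
      _ = a • (k • T) + b • (p • T) := by
        rw [add_smul, mul_smul, mul_smul, natCast_zsmul, natCast_zsmul]
      _ = 0 := by rw [h5, hA]; simp
  rw [← Finset.powerset_univ, Finset.sum_powerset, Finset.card_univ, Fintype.card_fin,
    Finset.sum_range_succ]
  obtain ⟨n, rfl⟩ : ∃ n, p = n + 1 := ⟨p - 1, by have := hp.pos; omega⟩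
  rw [Finset.sum_range_succ', Finset.sum_eq_zero]
  · rw [zero_add]
    congr 1
    · simp
    · have : Finset.powersetCard (n + 1) (Finset.univ : Finset (Fin (n + 1))) = {Finset.univ} := by
        have := Finset.powersetCard_self (Finset.univ : Finset (Fin (n + 1)))
        rwa [Finset.card_univ, Fintype.card_fin] at this
      rw [this, Finset.sum_singleton]
  · intro k hk
    rw [Finset.mem_range] at hk
    exact key (k + 1) (by omega) (by omega)

theorem finRotate_pow_self (p : ℕ) : finRotate p ^ p = 1 := by
  rcases p with _ | _ | p
  · rfl
  · exact Equiv.ext fun i => Subsingleton.elim (α := Fin 1) _ _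
  · have h := pow_orderOf_eq_one (finRotate (p + 2))
    rwa [← Equiv.Perm.lcm_cycleType, cycleType_finRotate, Multiset.lcm_singleton,
      normalize_eq] at h

variable (p : ℕ) {R : Type u} [CommRing R]

section Defs

variable (R) (V : Type u) [AddCommGroup V] [Module R V]

/-- The order-`p` permutation `σ : V^{⊗ p} → V^{⊗ p}` of the tensor factors. -/
noncomputable def sigma : (⨂[R]^p V) →ₗ[R] (⨂[R]^p V) :=
  (PiTensorProduct.reindex R (fun _ => V) (finRotate p)).toLinearMap

/-- The map `tr = id + σ + ⋯ + σ^{p-1}` on `V^{⊗ p}`. -/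
noncomputable def traceEnd : (⨂[R]^p V) →ₗ[R] (⨂[R]^p V) :=
  ∑ i ∈ Finset.range p, sigma p R V ^ i

/-- The endomorphism `id - σ` of `V^{⊗ p}`. -/
noncomputable def oneSubSigma : (⨂[R]^p V) →ₗ[R] (⨂[R]^p V) :=
  LinearMap.id - sigma p R V

/-- The module of coinvariants `(V^{⊗ p})_σ`. -/
abbrev Coinv : Type u := (⨂[R]^p V) ⧸ LinearMap.range (oneSubSigma p R V)

/-- The module of invariants `(V^{⊗ p})^σ`. -/
noncomputable abbrev Inv : Submodule R (⨂[R]^p V) := LinearMap.ker (oneSubSigma p R V)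

variable {R V}

theorem sigma_tprod (v : Fin p → V) :
    sigma p R V (PiTensorProduct.tprod R v) =
      PiTensorProduct.tprod R (fun i => v ((finRotate p).symm i)) :=
  PiTensorProduct.reindex_tprod _ _

variable (R V)

theorem sigma_pow_self : sigma p R V ^ p = 1 := by
  have h : ∀ k : ℕ, ∀ v : Fin p → V, (sigma p R V ^ k) (PiTensorProduct.tprod R v) =
      PiTensorProduct.tprod R (fun i => v (((finRotate p) ^ k).symm i)) := by
    intro k
    induction k with
    | zero => intro v; rfl
    | succ k ih =>
      intro v
      rw [pow_succ, Module.End.mul_apply, sigma_tprod, ih, pow_succ (finRotate p)]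
      rfl
  refine PiTensorProduct.ext (MultilinearMap.ext fun v => ?_)
  change (sigma p R V ^ p) (PiTensorProduct.tprod R v) = PiTensorProduct.tprod R v
  rw [h, finRotate_pow_self]
  rfl

theorem traceEnd_comp : traceEnd p R V ∘ₗ oneSubSigma p R V = 0 := by
  have h := geom_sum_mul (sigma p R V) p
  rw [sigma_pow_self, sub_self] at h
  refine LinearMap.ext fun x => ?_
  have h' : traceEnd p R V (sigma p R V x - x) = 0 := LinearMap.congr_fun h x
  change traceEnd p R V (x - sigma p R V x) = 0
  rw [← neg_sub, map_neg, h', neg_zero]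

theorem comp_traceEnd : oneSubSigma p R V ∘ₗ traceEnd p R V = 0 := by
  have h := mul_geom_sum (sigma p R V) p
  rw [sigma_pow_self, sub_self] at h
  refine LinearMap.ext fun x => ?_
  have h' : sigma p R V (traceEnd p R V x) - traceEnd p R V x = 0 := LinearMap.congr_fun h x
  change traceEnd p R V x - sigma p R V (traceEnd p R V x) = 0
  rw [← neg_sub, h', neg_zero]

/-- The trace map `tr : (V^{⊗ p})_σ → (V^{⊗ p})^σ`. -/
noncomputable def trace : Coinv p R V →ₗ[R] Inv p R V :=
  Submodule.liftQ _
    (LinearMap.codRestrict _ (traceEnd p R V)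
      (fun x => LinearMap.congr_fun (comp_traceEnd p R V) x))
    (by
      rintro _ ⟨x, rfl⟩
      exact Subtype.ext (LinearMap.congr_fun (traceEnd_comp p R V) x))

/-- The class of `v ⊗ ⋯ ⊗ v` in `(V^{⊗ p})_σ`. -/
noncomputable def powClass (v : V) : Coinv p R V :=
  Submodule.Quotient.mk (PiTensorProduct.tprod R (fun _ => v))

end Defs

section Maps

variable {V W X : Type u} [AddCommGroup V] [Module R V] [AddCommGroup W] [Module R W]
  [AddCommGroup X] [Module R X]

/-- The map `g^{⊗ p}`. -/
noncomputable def powMap (g : V →ₗ[R] W) : (⨂[R]^p V) →ₗ[R] (⨂[R]^p W) :=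
  PiTensorProduct.map (fun _ => g)

theorem powMap_sigma (g : V →ₗ[R] W) :
    powMap p g ∘ₗ sigma p R V = sigma p R W ∘ₗ powMap p g := by
  refine PiTensorProduct.ext (MultilinearMap.ext fun v => ?_)
  simp [powMap, sigma_tprod]

theorem powMap_id_sub_sigma (g : V →ₗ[R] W) (x : ⨂[R]^p V) :
    powMap p g (oneSubSigma p R V x) = oneSubSigma p R W (powMap p g x) := by
  have := LinearMap.congr_fun (powMap_sigma p g) x
  simp only [LinearMap.comp_apply] at this
  simp [oneSubSigma, this]

theorem powMap_traceEnd (g : V →ₗ[R] W) (x : ⨂[R]^p V) :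
    powMap p g (traceEnd p R V x) = traceEnd p R W (powMap p g x) := by
  have h : ∀ k : ℕ, ∀ x, powMap p g ((sigma p R V ^ k) x) = (sigma p R W ^ k) (powMap p g x) := by
    intro k
    induction k with
    | zero => intro x; rfl
    | succ k ih =>
      intro x
      rw [pow_succ, Module.End.mul_apply, ih, pow_succ, Module.End.mul_apply]
      congr 1
      exact LinearMap.congr_fun (powMap_sigma p g) x
  simp [traceEnd, h]

/-- Functoriality of the coinvariants. -/
noncomputable def coinvMap (g : V →ₗ[R] W) : Coinv p R V →ₗ[R] Coinv p R W :=
  Submodule.mapQ _ _ (powMap p g) (by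
    rintro _ ⟨x, rfl⟩
    exact ⟨powMap p g x, (powMap_id_sub_sigma p g x).symm⟩)

/-- Functoriality of the invariants. -/
noncomputable def invMap (g : V →ₗ[R] W) : Inv p R V →ₗ[R] Inv p R W :=
  (powMap p g).restrict (fun x hx => by
    rw [LinearMap.mem_ker] at hx ⊢
    rw [← powMap_id_sub_sigma, hx, map_zero])

theorem trace_coinvMap (g : V →ₗ[R] W) (x : Coinv p R V) :
    trace p R W (coinvMap p g x) = invMap p g (trace p R V x) := by
  obtain ⟨x, rfl⟩ := Submodule.Quotient.mk_surjective _ x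
  exact Subtype.ext (powMap_traceEnd p g x).symm

theorem powMap_id (x : ⨂[R]^p V) : powMap p (LinearMap.id : V →ₗ[R] V) x = x :=
  LinearMap.congr_fun PiTensorProduct.map_id x

theorem powMap_comp (h : W →ₗ[R] X) (g : V →ₗ[R] W) (x : ⨂[R]^p V) :
    powMap p (h ∘ₗ g) x = powMap p h (powMap p g x) :=
  LinearMap.congr_fun (PiTensorProduct.map_comp (fun _ => h) (fun _ => g)) x

/-- For a linear functional `f` on `V`, the functional `f^{⊗ p}` on `V^{⊗ p}`, with values in
`R = R^{⊗ p}`. -/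
noncomputable def powFun (f : V →ₗ[R] R) : (⨂[R]^p V) →ₗ[R] R :=
  PiTensorProduct.lift ((MultilinearMap.mkPiAlgebra R (Fin p) R).compLinearMap (fun _ => f))

theorem powFun_tprod (f : V →ₗ[R] R) (v : Fin p → V) :
    powFun p f (PiTensorProduct.tprod R v) = ∏ i, f (v i) := by
  simp [powFun]

theorem powFun_powMap (f : W →ₗ[R] R) (g : V →ₗ[R] W) (x : ⨂[R]^p V) :
    powFun p f (powMap p g x) = powFun p (f ∘ₗ g) x := by
  have : powFun p f ∘ₗ powMap p g = powFun p (f ∘ₗ g) := by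
    refine PiTensorProduct.ext (MultilinearMap.ext fun v => ?_)
    simp [powMap, powFun_tprod]
  exact LinearMap.congr_fun this x

theorem powFun_sigma (f : V →ₗ[R] R) (x : ⨂[R]^p V) :
    powFun p f (sigma p R V x) = powFun p f x := by
  have : powFun p f ∘ₗ sigma p R V = powFun p f := by
    refine PiTensorProduct.ext (MultilinearMap.ext fun v => ?_)
    simp only [LinearMap.compMultilinearMap_apply, LinearMap.comp_apply, sigma_tprod, powFun_tprod]
    exact Equiv.prod_comp (finRotate p).symm (fun i => f (v i))
  exact LinearMap.congr_fun this x

end Maps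

end Cyclic

/-! ### The maps `ψ` and `ψ̂` -/

section Psi

set_option linter.unusedSectionVars false

variable {p : ℕ} [Fact p.Prime] {R : Type u} [CommRing R] (hR : (p : R) = 0)
  {V W : Type u} [AddCommGroup V] [Module R V] [AddCommGroup W] [Module R W]

theorem nsmul_eq_zero_of (hR : (p : R) = 0) {X : Type*} [AddCommGroup X] [Module R X] (x : X) :
    p • x = 0 := by
  rw [← Nat.cast_smul_eq_nsmul R, hR, zero_smul]

theorem rotate_piecewise {X : Type*} (S : Finset (Fin p)) (v w : X) :
    (fun i => S.piecewise (fun _ => v) (fun _ => w) ((finRotate p).symm i)) =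
      (S.map (finRotate p).toEmbedding).piecewise (fun _ => v) (fun _ => w) := by
  funext i
  simp [Finset.piecewise, Finset.mem_map_equiv]

theorem powClass_add (hR : (p : R) = 0) (v w : V) :
    powClass p R V (v + w) = powClass p R V v + powClass p R V w := by
  have h := (PiTensorProduct.tprod R (s := fun _ : Fin p => V)).map_add_univ
    (fun _ => v) (fun _ => w)
  have h' := sum_rotation (nsmul_eq_zero_of hR (X := Coinv p R V))
    (fun S => Submodule.Quotient.mk
      (PiTensorProduct.tprod R (S.piecewise (fun _ => v) (fun _ => w)))) (by
    intro S
    refine Eq.symm ((Submodule.Quotient.eq (LinearMap.range (oneSubSigma p R V))).2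
      (LinearMap.mem_range.2
        ⟨PiTensorProduct.tprod R (S.piecewise (fun _ => v) (fun _ => w)), ?_⟩))
    change _ - sigma p R V _ = _
    rw [sigma_tprod, rotate_piecewise]
    rfl)
  have h0 : powClass p R V (v + w) = ∑ S : Finset (Fin p), Submodule.Quotient.mk
      (PiTensorProduct.tprod R (S.piecewise (fun _ => v) (fun _ => w))) := by
    have := congrArg (LinearMap.range (oneSubSigma p R V)).mkQ h
    rw [map_sum] at this
    exact this
  rw [h0, h', add_comm]
  simp [powClass]

theorem powClass_smul (r : R) (v : V) :
    powClass p R V (r • v) = r ^ p • powClass p R V v := by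
  have h := (PiTensorProduct.tprod R (s := fun _ : Fin p => V)).map_smul_univ
    (fun _ => r) (fun _ => v)
  rw [Finset.prod_const, Finset.card_univ, Fintype.card_fin] at h
  exact congrArg (LinearMap.range (oneSubSigma p R V)).mkQ h

theorem powFun_add (hR : (p : R) = 0) (f g : V →ₗ[R] R) (x : ⨂[R]^p V) (hx : x ∈ Inv p R V) :
    powFun p (f + g) x = powFun p f x + powFun p g x := by
  let F (S : Finset (Fin p)) : (⨂[R]^p V) →ₗ[R] R := PiTensorProduct.lift
    ((MultilinearMap.mkPiAlgebra R (Fin p) R).compLinearMap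
      (S.piecewise (fun _ => f) (fun _ => g)))
  have hF : ∀ S (v : Fin p → V), F S (PiTensorProduct.tprod R v) =
      ∏ i, S.piecewise (fun _ => f) (fun _ => g) i (v i) := by
    intro S v
    simp [F]
  have h1 : powFun p (f + g) = ∑ S : Finset (Fin p), F S := by
    refine PiTensorProduct.ext (MultilinearMap.ext fun v => ?_)
    simp only [LinearMap.compMultilinearMap_apply, powFun_tprod, LinearMap.add_apply,
      LinearMap.sum_apply, hF, Finset.prod_add]
    rw [Finset.powerset_univ]
    refine Finset.sum_congr rfl fun S _ => ?_
    rw [← Finset.prod_mul_prod_compl S]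
    congr 1
    · exact Finset.prod_congr rfl fun i hi => by simp [hi]
    · rw [Finset.compl_eq_univ_sdiff]
      exact Finset.prod_congr rfl fun i hi => by
        rw [Finset.piecewise_eq_of_notMem _ _ _ (Finset.mem_sdiff.1 hi).2]
  have h2 : ∀ S, F (S.map (finRotate p).toEmbedding) ∘ₗ sigma p R V = F S := by
    intro S
    refine PiTensorProduct.ext (MultilinearMap.ext fun v => ?_)
    simp only [LinearMap.compMultilinearMap_apply, LinearMap.comp_apply, sigma_tprod, hF]
    rw [← rotate_piecewise]
    exact Equiv.prod_comp (finRotate p).symm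
      (fun i => S.piecewise (fun _ => f) (fun _ => g) i (v i))
  have hx' : sigma p R V x = x := by
    have : x - sigma p R V x = 0 := hx
    exact (sub_eq_zero.1 this).symm
  have h3 := sum_rotation (nsmul_eq_zero_of hR (X := R)) (fun S => F S x) (by
    intro S
    have := LinearMap.congr_fun (h2 S) x
    rwa [LinearMap.comp_apply, hx'] at this)
  rw [h1, LinearMap.sum_apply, h3, add_comm]
  simp [F, powFun]

theorem powFun_smul (r : R) (f : V →ₗ[R] R) (x : ⨂[R]^p V) :
    powFun p (r • f) x = r ^ p * powFun p f x := by
  have : powFun p (r • f) = r ^ p • powFun p f := by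
    refine PiTensorProduct.ext (MultilinearMap.ext fun v => ?_)
    simp [powFun_tprod, Finset.prod_mul_distrib]
  exact LinearMap.congr_fun this x

/-- The twist `V^{(1)} = R^{(1)} ⊗_R V`. -/
abbrev VTwist (V : Type u) [AddCommGroup V] [Module R V] : Type u := Twist hR R ⊗[R] V

/-- The Frobenius map `Fr : V → V^{(1)}`, obtained by tensoring `R → R^{(1)}`, `r ↦ r ^ p = r • 1`,
with `V`. -/
noncomputable def frobMap (V : Type u) [AddCommGroup V] [Module R V] : V →ₗ[R] VTwist hR V :=
  TensorProduct.mk R (Twist hR R) V (toTwist hR R 1)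

/-- The map `ψ : V^{(1)} → (V^{⊗ p})_σ`, `r ⊗ v ↦ r [v ⊗ ⋯ ⊗ v]`. It is linear when `R` acts on the
target through the Frobenius map. -/
noncomputable def psi (V : Type u) [AddCommGroup V] [Module R V] :
    VTwist hR V →ₗ[R] Twist hR (Coinv p R V) :=
  TensorProduct.lift (LinearMap.mk₂ R
    (fun (r : Twist hR R) (v : V) =>
      toTwist hR (Coinv p R V) ((toTwist hR R).symm r • powClass p R V v))
    (fun r s v => by simp [add_smul])
    (fun c r v => by
      obtain ⟨r, rfl⟩ := (toTwist hR R).surjective r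
      simp [smul_toTwist, mul_smul])
    (fun r v w => by simp [powClass_add hR])
    (fun c r v => by
      simp only [powClass_smul, smul_toTwist]
      rw [smul_comm]))

/-- For a functional `f : V → R`, the functional `f^{(1)} : V^{(1)} → R^{(1)}`,
`r ⊗ v ↦ r * f(v) ^ p`. -/
noncomputable def twistFun (f : V →ₗ[R] R) : VTwist hR V →ₗ[R] Twist hR R :=
  (TensorProduct.rid R (Twist hR R)).toLinearMap ∘ₗ LinearMap.lTensor (Twist hR R) f

theorem twistFun_tmul (f : V →ₗ[R] R) (r : R) (v : V) :
    twistFun hR f (toTwist hR R r ⊗ₜ[R] v) = toTwist hR R (f v ^ p * r) := by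
  simp [twistFun, smul_toTwist]

/-- Functionals of the form `f^{(1)}` separate the points of `V^{(1)}`. -/
theorem twistFun_ext [Module.Finite R V] [Module.Projective R V] {y z : VTwist hR V}
    (h : ∀ f : V →ₗ[R] R, twistFun hR f y = twistFun hR f z) : y = z := by
  obtain ⟨n, e, g, -, -, heg⟩ := Module.Finite.exists_comp_eq_id_of_projective R V
  have key : ∀ y : VTwist hR V,
      y = ∑ i : Fin n, twistFun hR (LinearMap.proj i ∘ₗ g) y ⊗ₜ[R] e (Pi.single i 1) := by
    intro y
    induction y using TensorProduct.induction_on with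
    | zero => simp
    | add y z hy hz =>
      conv_lhs => rw [hy, hz]
      simp [TensorProduct.add_tmul, Finset.sum_add_distrib]
    | tmul r v =>
      have hv : v = ∑ i : Fin n, g v i • e (Pi.single i 1) := by
        have h1 : e (g v) = v := LinearMap.congr_fun heg v
        conv_lhs => rw [← h1, pi_eq_sum_univ' (g v)]
        simp
      conv_lhs => rw [hv, TensorProduct.tmul_sum]
      refine Finset.sum_congr rfl fun i _ => ?_
      rw [← TensorProduct.smul_tmul]
      simp [twistFun]
  rw [key y, key z]
  simp [h]

/-- Existence of the transpose of `ψ`. -/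
theorem exists_psiHat (V : Type u) [AddCommGroup V] [Module R V] [Module.Finite R V]
    [Module.Projective R V] :
    ∃ ψ : Twist hR (Inv p R V) →ₗ[R] VTwist hR V, ∀ (f : V →ₗ[R] R) (x : Inv p R V),
      twistFun hR f (ψ (toTwist hR _ x)) = toTwist hR R (powFun p f x) := by
  obtain ⟨n, e, g, -, -, heg⟩ := Module.Finite.exists_comp_eq_id_of_projective R V
  refine ⟨∑ i : Fin n, (TensorProduct.mk R (Twist hR R) V).flip (e (Pi.single i 1)) ∘ₗ
    twistMap hR (powFun p (LinearMap.proj i ∘ₗ g) ∘ₗ (Inv p R V).subtype), fun f x => ?_⟩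
  have hf : f = ∑ i : Fin n, f (e (Pi.single i 1)) • (LinearMap.proj i ∘ₗ g) := by
    refine LinearMap.ext fun v => ?_
    have h1 : e (g v) = v := LinearMap.congr_fun heg v
    conv_lhs => rw [← h1, ← LinearMap.sum_single_apply (fun _ => R) (g v), map_sum, map_sum]
    rw [LinearMap.sum_apply]
    refine Finset.sum_congr rfl fun i _ => ?_
    have h2 : Pi.single i (g v i) = g v i • Pi.single (M := fun _ => R) i (1 : R) := by
      rw [← Pi.single_smul, smul_eq_mul, mul_one]
    change f (e (Pi.single i (g v i))) = _
    rw [h2, map_smul, map_smul]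
    simp [mul_comm]
  have hsum : ∀ s : Finset (Fin n),
      powFun p (∑ i ∈ s, f (e (Pi.single i 1)) • (LinearMap.proj i ∘ₗ g)) (x : ⨂[R]^p V) =
        ∑ i ∈ s, f (e (Pi.single i 1)) ^ p * powFun p (LinearMap.proj i ∘ₗ g) x := by
    intro s
    induction s using Finset.induction_on with
    | empty =>
      have := powFun_smul (p := p) (0 : R) (0 : V →ₗ[R] R) (x : ⨂[R]^p V)
      rw [zero_smul, zero_pow (Fact.out : p.Prime).ne_zero, zero_mul] at this
      simpa using this
    | insert i s his ih =>
      rw [Finset.sum_insert his, Finset.sum_insert his, powFun_add hR _ _ _ x.2, powFun_smul, ih]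
  conv_rhs => rw [hf, hsum]
  rw [LinearMap.sum_apply, map_sum, map_sum]
  exact Finset.sum_congr rfl fun i _ => twistFun_tmul hR f _ _

/-- The map `ψ̂ : (V^{⊗ p})^σ → V^{(1)}` for a finitely generated projective module `V`. It is the
transpose of the map `ψ` for the dual module `V^*`: for `x` invariant and `f ∈ V^*`, the pairing of
`ψ̂ x` with `1 ⊗ f ∈ (V^*)^{(1)}` equals the pairing of `x` with `ψ(1 ⊗ f) = [f ⊗ ⋯ ⊗ f]`. This
characterises `ψ̂ x`, since functionals of this form separate the points of `V^{(1)}`. -/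
noncomputable def psiHat (V : Type u) [AddCommGroup V] [Module R V] [Module.Finite R V]
    [Module.Projective R V] : Twist hR (Inv p R V) →ₗ[R] VTwist hR V :=
  Classical.choose (exists_psiHat hR V)

theorem twistFun_psiHat [Module.Finite R V] [Module.Projective R V] (f : V →ₗ[R] R)
    (x : Inv p R V) :
    twistFun hR f (psiHat hR V (toTwist hR _ x)) = toTwist hR R (powFun p f x) :=
  Classical.choose_spec (exists_psiHat hR V) f x

/-- Naturality of `ψ̂`. -/
theorem psiHat_invMap [Module.Finite R V] [Module.Projective R V] [Module.Finite R W]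
    [Module.Projective R W] (g : V →ₗ[R] W) (x : Twist hR (Inv p R V)) :
    psiHat hR W (twistMap hR (invMap p g) x) =
      LinearMap.lTensor (Twist hR R) g (psiHat hR V x) := by
  obtain ⟨x, rfl⟩ := (toTwist hR (Inv p R V)).surjective x
  refine twistFun_ext hR fun f => ?_
  have h1 : twistFun hR f (LinearMap.lTensor (Twist hR R) g (psiHat hR V (toTwist hR _ x))) =
      twistFun hR (f ∘ₗ g) (psiHat hR V (toTwist hR _ x)) := by
    rw [twistFun, twistFun, LinearMap.lTensor_comp]
    rfl
  have h2 : twistMap hR (invMap p g) (toTwist hR _ x) = toTwist hR _ (invMap p g x) := rfl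
  rw [h1, h2, twistFun_psiHat, twistFun_psiHat]
  exact congrArg (toTwist hR R) (powFun_powMap p f g x)

/-- The composite `ψ̂ ∘ tr` vanishes. -/
theorem psiHat_trace [Module.Finite R V] [Module.Projective R V] (x : Coinv p R V) :
    psiHat hR V (toTwist hR _ (trace p R V x)) = 0 := by
  refine twistFun_ext hR fun f => ?_
  rw [twistFun_psiHat, map_zero]
  obtain ⟨x, rfl⟩ := Submodule.Quotient.mk_surjective _ x
  have h : powFun p f (traceEnd p R V x) = 0 := by
    have hk : ∀ k : ℕ, powFun p f ((sigma p R V ^ k) x) = powFun p f x := by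
      intro k
      induction k with
      | zero => rfl
      | succ k ih => rw [pow_succ', Module.End.mul_apply, powFun_sigma, ih]
    rw [traceEnd, LinearMap.sum_apply, map_sum, Finset.sum_congr rfl fun k _ => hk k,
      Finset.sum_const, Finset.card_range, nsmul_eq_zero_of hR]
  exact congrArg (toTwist hR R) h

/-- The composite `tr ∘ ψ` vanishes. -/
theorem trace_psi (y : VTwist hR V) : twistMap hR (trace p R V) (psi hR V y) = 0 := by
  induction y using TensorProduct.induction_on with
  | zero => simp
  | add y z hy hz => rw [map_add, map_add, hy, hz, add_zero]
  | tmul r v =>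
    obtain ⟨r, rfl⟩ := (toTwist hR R).surjective r
    have hk : ∀ k : ℕ, (sigma p R V ^ k) (PiTensorProduct.tprod R fun _ => v) =
        PiTensorProduct.tprod R fun _ => v := by
      intro k
      induction k with
      | zero => rfl
      | succ k ih => rw [pow_succ', Module.End.mul_apply, ih, sigma_tprod]
    have h : traceEnd p R V (PiTensorProduct.tprod R fun _ => v) = 0 := by
      rw [traceEnd, LinearMap.sum_apply, Finset.sum_congr rfl fun k _ => hk k,
        Finset.sum_const, Finset.card_range, nsmul_eq_zero_of hR]
    have h' : trace p R V (powClass p R V v) = 0 := Subtype.ext h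
    have h'' : trace p R V (r • powClass p R V v) = 0 := by rw [map_smul, h', smul_zero]
    exact congrArg (toTwist hR _) h''

/-- Naturality of `ψ`. -/
theorem psi_lTensor (g : V →ₗ[R] W) (y : VTwist hR V) :
    psi hR W (LinearMap.lTensor (Twist hR R) g y) = twistMap hR (coinvMap p g) (psi hR V y) := by
  induction y using TensorProduct.induction_on with
  | zero => simp
  | add y z hy hz => simp only [map_add, hy, hz]
  | tmul r v =>
    obtain ⟨r, rfl⟩ := (toTwist hR R).surjective r
    have h : coinvMap p g (powClass p R V v) = powClass p R W (g v) :=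
      congrArg Submodule.Quotient.mk (PiTensorProduct.map_tprod (fun _ => g) (fun _ => v))
    have h' : r • powClass p R W (g v) = coinvMap p g (r • powClass p R V v) := by
      rw [map_smul, h]
    exact congrArg (toTwist hR _) h'

end Psi

/-! ### The cyclic-power extension -/

section CyclicExtension

variable {p : ℕ} [Fact p.Prime] {R : Type u} [CommRing R] (hR : (p : R) = 0)

instance (V : RProj R) : Module.Finite R V.obj := V.property.1

instance (V : RProj R) : Module.Projective R V.obj := V.property.2

/-- The degree `0` term of the pullback of `tr : (V^{⊗ p})_σ → (V^{⊗ p})^σ` along the Frobenius map: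
the fibre product of `ψ̂ : (V^{⊗ p})^σ → V^{(1)}` and `Fr : V → V^{(1)}`. -/
noncomputable abbrev fibre (V : RProj R) : Submodule R (Twist hR (Inv p R V.obj) × V.obj) :=
  LinearMap.ker ((psiHat hR V.obj) ∘ₗ LinearMap.fst R _ _ - frobMap hR V.obj ∘ₗ LinearMap.snd R _ _)

theorem mem_fibre {V : RProj R} {x : Twist hR (Inv p R V.obj) × V.obj} :
    x ∈ fibre hR V ↔ psiHat hR V.obj x.1 = frobMap hR V.obj x.2 :=
  sub_eq_zero

/-- Functoriality of the fibre product. -/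
noncomputable def fibreMap {V W : RProj R} (g : V.obj →ₗ[R] W.obj) : fibre hR V →ₗ[R] fibre hR W :=
  (LinearMap.prodMap (twistMap hR (invMap p g)) g).restrict (fun x hx => by
    rw [mem_fibre] at hx ⊢
    change psiHat hR W.obj (twistMap hR (invMap p g) x.1) = frobMap hR W.obj (g x.2)
    rw [psiHat_invMap, hx]
    rfl)

/-- The functor `C₁ : V ↦ (V^{⊗ p})_σ`, where `R` acts through the Frobenius map. -/
noncomputable def cyclicC₁ : RProj R ⥤ ModuleCat.{u} R where
  obj V := ModuleCat.of R (Twist hR (Coinv p R V.obj))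
  map g := ModuleCat.ofHom (twistMap hR (coinvMap p g.hom.hom))
  map_id V := by
    ext x
    obtain ⟨x, rfl⟩ := Submodule.Quotient.mk_surjective _ x
    exact congrArg Submodule.Quotient.mk (powMap_id p x)
  map_comp f g := by
    ext x
    obtain ⟨x, rfl⟩ := Submodule.Quotient.mk_surjective _ x
    exact congrArg Submodule.Quotient.mk (powMap_comp p g.hom.hom f.hom.hom x)

/-- The functor `C₀ : V ↦ (V^{⊗ p})^σ ×_{V^{(1)}} V`, where `R` acts on the first factor through the
Frobenius map. -/
noncomputable def cyclicC₀ : RProj R ⥤ ModuleCat.{u} R where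
  obj V := ModuleCat.of R (fibre hR V)
  map g := ModuleCat.ofHom (fibreMap hR g.hom.hom)
  map_id V := by
    refine ModuleCat.hom_ext (LinearMap.ext fun x => Subtype.ext (Prod.ext ?_ rfl))
    exact Subtype.ext (powMap_id p (x.1.1 : Inv p R V.obj).1)
  map_comp f g := by
    refine ModuleCat.hom_ext (LinearMap.ext fun x => Subtype.ext (Prod.ext ?_ rfl))
    exact Subtype.ext (powMap_comp p g.hom.hom f.hom.hom (x.1.1 : Inv p R _).1)

/-- The sequence `0 ⟶ I(R^{(1)}) --b--> C₁ --d--> C₀ --a--> I ⟶ 0` obtained by pulling back the trace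
complex `tr : (V^{⊗ p})_σ → (V^{⊗ p})^σ` along `Fr : V → V^{(1)}`: here `b` is `ψ`, `d` is
`x ↦ (tr x, 0)` and `a` is `(x, v) ↦ v`. -/
noncomputable def cyclicExtension : FourTerm R (Twist hR R) where
  C₁ := cyclicC₁ hR
  C₀ := cyclicC₀ hR
  b :=
    { app := fun V => ModuleCat.ofHom (psi hR V.obj)
      naturality := fun V W g => by
        ext : 1
        exact LinearMap.ext fun y => psi_lTensor hR g.hom.hom y }
  d :=
    { app := fun V => ModuleCat.ofHom
        (LinearMap.codRestrict (fibre hR V)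
          ((LinearMap.inl R _ _) ∘ₗ twistMap hR (trace p R V.obj))
          (fun x => by
            rw [mem_fibre]
            exact (psiHat_trace hR x).trans (map_zero (frobMap hR V.obj)).symm))
      naturality := fun V W g => by
        refine ModuleCat.hom_ext (LinearMap.ext fun x => Subtype.ext (Prod.ext ?_ ?_))
        · exact trace_coinvMap p g.hom.hom x
        · exact (map_zero g.hom.hom).symm }
  a :=
    { app := fun V => ModuleCat.ofHom (LinearMap.snd R _ _ ∘ₗ (fibre hR V).subtype)
      naturality := fun V W g => rfl }
  b_d := by
    ext V : 3
    exact LinearMap.ext fun y => Subtype.ext (Prod.ext (trace_psi hR y) rfl)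
  d_a := by
    ext V x
    rfl

end CyclicExtension

/-! ### Second Witt vectors -/

section Witt

variable {p : ℕ} [Fact p.Prime] {R : Type u} [CommRing R]

/-- The projection `W₂(R) → R`, `(x₀, x₁) ↦ x₀`. -/
noncomputable def wittProj (p : ℕ) [Fact p.Prime] (R : Type u) [CommRing R] :
    TruncatedWittVector p 2 R →+* R where
  toFun x := x.coeff 0
  map_one' := by
    rw [← map_one (WittVector.truncate 2), WittVector.coeff_truncate]
    exact WittVector.one_coeff_zero p R
  map_mul' x y := by
    obtain ⟨x, rfl⟩ := WittVector.truncate_surjective p 2 R x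
    obtain ⟨y, rfl⟩ := WittVector.truncate_surjective p 2 R y
    rw [← map_mul]
    simp only [WittVector.coeff_truncate]
    exact WittVector.mul_coeff_zero x y
  map_zero' := TruncatedWittVector.coeff_zero p 2 R 0
  map_add' x y := by
    obtain ⟨x, rfl⟩ := WittVector.truncate_surjective p 2 R x
    obtain ⟨y, rfl⟩ := WittVector.truncate_surjective p 2 R y
    rw [← map_add]
    simp only [WittVector.coeff_truncate]
    exact WittVector.add_coeff_zero x y

/-- The inclusion `R^{(1)} → W₂(R)`, `x ↦ (0, x)`. -/
noncomputable def wittIncl (hR : (p : R) = 0) : Twist hR R →+ TruncatedWittVector p 2 R where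
  toFun x := TruncatedWittVector.mk p ![0, (toTwist hR R).symm x]
  map_zero' := by
    ext i
    fin_cases i <;> simp
  map_add' x y := by
    have h : ∀ w : WittVector p R, TruncatedWittVector.mk p ![0, w.coeff 0] =
        WittVector.truncate 2 (WittVector.verschiebung w) := by
      intro w
      ext i
      rw [WittVector.coeff_truncate]
      fin_cases i
      · exact (WittVector.verschiebung_coeff_zero w).symm
      · exact (WittVector.verschiebung_coeff_succ w 0).symm
    have hx := h (WittVector.teichmuller p ((toTwist hR R).symm x))
    have hy := h (WittVector.teichmuller p ((toTwist hR R).symm y))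
    have hxy := h (WittVector.teichmuller p ((toTwist hR R).symm x) +
      WittVector.teichmuller p ((toTwist hR R).symm y))
    rw [map_add, map_add, ← hx, ← hy] at hxy
    simpa only [WittVector.add_coeff_zero, WittVector.teichmuller_coeff_zero, map_add] using hxy

end Witt

end CyclicPower

/-! Nonconstant words of prime length `p` have free rotation orbits. An integral weight that
vanishes on constant words and has total 1 along the rotations of any other word therefore acts as a
division by `p`, with no choice of orbit representatives (`IsOrbitWeight`). Multiplying the basis
tensors of a free module by such a weight gives an operator `h` with `∑ σ^k h σ^{-k} = id -
(projection to the diagonal)` (`exists_contraction`). Applied to invariants, and to classes of trace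
zero, this shows that `ker ψ̂ = Im tr` and `ker tr = Im ψ` on free modules. Projective modules are
retracts of free ones, and functionals separate points of `V^{(1)}`, which gives the injectivity of
`ψ`. Surjectivity of `a` comes from the elements `(v^{⊗p}, v)`.

The same weight on words in two letters produces a tensor with trace `(v+w)^{⊗p} - v^{⊗p} - w^{⊗p}`.
Its class in `(V^{⊗p})_σ` is a symmetric 2-cocycle, since weighted sums of rotation-invariant
functions do not depend on the weight (`IsOrbitWeight.sum_eq`). Twisting the addition on `V ×
(V^{⊗p})_σ` by it gives a splitting (`wittSplitting`).

For an arbitrary splitting `S`, functoriality supplies a multiplicative section `r ↦ C₀₁(r · id)` of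
`R' → R`, just as Teichmüller lifts supply one for `W₂(R) → R`. Two square-zero extensions having
multiplicative sections with the same additive defect are isomorphic
(`IsSquareZeroExtension.exists_ringEquiv`), so it suffices to compute the defects. For Teichmüller
lifts the defect is `κ(r,s) = ((r+s)^p - r^p - s^p)/p`, read as an integral polynomial
(`coeff_teichmuller_add`). For `S`, the failure of `C₀₁` to be additive on linear maps is forced by
the extension itself (`Splitting.mapLin_add`): in the universal case of the two inclusions `V → V ⊕
V`, any ambiguity lies in `(V ⊕ V)^{(1)}`, which is additive and so is detected by the two
projections, where it vanishes. For scalar maps this defect is again `κ(r,s)`, by `crossPow_smul_id`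
and the identity `psi_psiHat`. -/

namespace CyclicPower

universe u v w

/-! ### Integral weights on words that sum to 1 over free rotation orbits. -/

section Weights

set_option linter.unusedSectionVars false

variable {p : ℕ} [Fact p.Prime] {A : Type*}

/-- An integral weight on words of length `p` is an orbit weight if it vanishes on constant words
and its values on the rotations of any other word add up to `1`. -/
structure IsOrbitWeight (W : (Fin p → A) → ℤ) : Prop where
  const : ∀ a, W (fun _ => a) = 0
  sum_rotate : ∀ f : Fin p → A, (¬∃ a, f = fun _ => a) → ∑ k, W (fun i => f (i + k)) = 1

theorem IsOrbitWeight.sum_rotate_eq {W : (Fin p → A) → ℤ} (hW : IsOrbitWeight W)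
    (f : Fin p → A) [Decidable (∃ a, f = fun _ => a)] :
    ∑ k, W (fun i => f (i + k)) = if ∃ a, f = fun _ => a then 0 else 1 := by
  split_ifs with h
  · obtain ⟨a, rfl⟩ := h
    simp [hW.const]
  · exact hW.sum_rotate f h

/-- The rotation of words as a permutation. -/
def rotateWord (p : ℕ) [Fact p.Prime] (A : Type*) (k : Fin p) : (Fin p → A) ≃ (Fin p → A) :=
  (Equiv.addRight k).symm.arrowCongr (Equiv.refl A)

theorem rotateWord_apply (k : Fin p) (f : Fin p → A) :
    rotateWord p A k f = fun i => f (i + k) := rfl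

/-- For each `k`, the substitution that rotates `f` moves the rotation from `G` onto the weight. -/
theorem sum_sum_rotate [Fintype A] {R M : Type*} [CommRing R] [AddCommGroup M] [Module R M]
    (W : (Fin p → A) → ℤ) (G : (Fin p → A) → M) :
    ∑ k : Fin p, ∑ f, (W f : R) • G (fun i => f (i - k)) =
      ∑ f, ((∑ k, W (fun i => f (i + k)) : ℤ) : R) • G f := by
  classical
  simp only [Int.cast_sum, Finset.sum_smul]
  rw [Finset.sum_comm (s := (Finset.univ : Finset (Fin p → A)))]
  refine Finset.sum_congr rfl fun k _ => ?_
  rw [← (rotateWord p A k).sum_comp]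
  simp [rotateWord_apply]

/-- The trace of a weighted sum over words is the sum over the nonconstant words. -/
theorem IsOrbitWeight.sum_sum_rotate [Fintype A] {R M : Type*} [CommRing R] [AddCommGroup M]
    [Module R M] {W : (Fin p → A) → ℤ} (hW : IsOrbitWeight W) (G : (Fin p → A) → M) :
    ∑ k : Fin p, ∑ f, (W f : R) • G (fun i => f (i - k)) = ∑ f, G f - ∑ a, G (fun _ => a) := by
  classical
  rw [CyclicPower.sum_sum_rotate]
  simp only [hW.sum_rotate_eq, Int.cast_ite, Int.cast_zero, Int.cast_one, ite_smul, zero_smul,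
    one_smul]
  have hp : p ≠ 0 := (Fact.out : p.Prime).ne_zero
  have hc : ∑ a, G (fun _ => a) =
      ∑ f : Fin p → A, if ∃ a, f = fun _ => a then G f else 0 := by
    rw [← Finset.sum_filter]
    refine Finset.sum_bij (fun a _ => fun _ => a) ?_ ?_ ?_ ?_
    · intro a _
      exact Finset.mem_filter.2 ⟨Finset.mem_univ _, a, rfl⟩
    · intro a _ b _ h
      exact congrFun h ⟨0, Nat.pos_of_ne_zero hp⟩
    · intro f hf
      obtain ⟨a, rfl⟩ := (Finset.mem_filter.1 hf).2
      exact ⟨a, Finset.mem_univ a, rfl⟩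
    · intro a _
      rfl
  rw [hc, eq_sub_iff_add_eq, ← Finset.sum_add_distrib]
  refine Finset.sum_congr rfl fun f _ => ?_
  split_ifs <;> simp

/-- The weighted sum of a rotation-invariant function does not depend on the orbit weight. -/
theorem IsOrbitWeight.sum_eq [Fintype A] {R M : Type*} [CommRing R] [AddCommGroup M] [Module R M]
    {W W' : (Fin p → A) → ℤ} (hW : IsOrbitWeight W) (hW' : IsOrbitWeight W')
    (g : (Fin p → A) → M) (hg : ∀ k f, g (fun i => f (i + k)) = g f) :
    ∑ f, (W f : R) • g f = ∑ f, (W' f : R) • g f := by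
  classical
  have hg' : ∀ k f, g (fun i => f (i - k)) = g f := fun k f => by
    simpa using (hg k (fun i => f (i - k))).symm
  -- Insert the factor `∑ k, U' (f rotated by k)`, which is 1 wherever `U` can be nonzero, then
  -- interchange the sums and rotate back; `g` does not notice the rotation. This trades `U` for
  -- `U'` at the cost of a rotation sum of `U`, which is again 1 on nonconstant words.
  have key : ∀ {U U' : (Fin p → A) → ℤ}, IsOrbitWeight U → IsOrbitWeight U' →
      ∑ f, (U f : R) • g f =
        ∑ f, (U' f : R) • (((∑ k, U (fun i => f (i - k)) : ℤ) : R) • g f) := by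
    intro U U' hU hU'
    have h1 : ∀ f, (U f : R) • g f =
        ((∑ k, U' (fun i => f (i + k)) : ℤ) : R) • ((U f : R) • g f) := by
      intro f
      rw [hU'.sum_rotate_eq]
      split_ifs with h
      · obtain ⟨a, rfl⟩ := h
        simp [hU.const]
      · rw [Int.cast_one, one_smul]
    rw [Finset.sum_congr rfl fun f _ => h1 f,
      ← CyclicPower.sum_sum_rotate U' (fun f => (U f : R) • g f), Finset.sum_comm]
    refine Finset.sum_congr rfl fun f _ => ?_
    simp only [hg', Int.cast_sum, Finset.sum_smul, Finset.smul_sum]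
  have h2 : ∀ f : Fin p → A,
      (W' f : R) • (((∑ k, W (fun i => f (i - k)) : ℤ) : R) • g f) = (W' f : R) • g f := by
    intro f
    have h3 : ∑ k, W (fun i => f (i - k)) = ∑ k, W (fun i => f (i + k)) := by
      rw [← Equiv.sum_comp (Equiv.neg (Fin p))]
      simp [sub_neg_eq_add]
    rw [h3, hW.sum_rotate_eq]
    split_ifs with h
    · obtain ⟨a, rfl⟩ := h
      simp [hW'.const]
    · rw [Int.cast_one, one_smul]
  rw [key hW hW', Finset.sum_congr rfl fun f _ => h2 f]

/-- An orbit weight on words in two letters. -/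
def boolWeight (f : Fin p → Bool) : ℤ :=
  if (∃ a, f = fun _ => a) then 0 else
    (if f 0 then Nat.gcdA (Finset.univ.filter fun i => f i = true).card p else 0) +
      Nat.gcdB (Finset.univ.filter fun i => f i = true).card p

/-- A nonconstant word has `n` letters `true` with `0 < n < p`, so `n` is prime to `p`. Among its
`p` rotations exactly `n` begin with `true`, and the total weight is the Bézout expression `n * gcdA
n p + p * gcdB n p = 1`. -/
theorem isOrbitWeight_boolWeight : IsOrbitWeight (boolWeight (p := p)) where
  const a := if_pos ⟨a, rfl⟩
  sum_rotate f hf := by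
    have hp : p.Prime := Fact.out
    have h0 : ∀ k : Fin p, ¬∃ a, (fun i => f (i + k)) = fun _ => a := by
      rintro k ⟨a, ha⟩
      exact hf ⟨a, funext fun i => by simpa using congrFun ha (i - k)⟩
    have hcard : ∀ k : Fin p, (Finset.univ.filter fun i => f (i + k) = true).card =
        (Finset.univ.filter fun i => f i = true).card := by
      intro k
      refine Finset.card_bij (fun i _ => i + k) ?_ ?_ ?_
      · intro i hi
        simpa using hi
      · intro i _ j _ h
        simpa using h
      · intro i hi
        exact ⟨i - k, by simpa using hi, by simp⟩
    set n := (Finset.univ.filter fun i => f i = true).card with hn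
    have hn0 : 0 < n := by
      rw [Nat.pos_iff_ne_zero]
      intro h
      rw [hn, Finset.card_eq_zero, Finset.filter_eq_empty_iff] at h
      exact hf ⟨false, funext fun i => by simpa using h (Finset.mem_univ i)⟩
    have hnp : n < p := by
      have h1 : n ≤ p := by
        simpa using Finset.card_filter_le (Finset.univ : Finset (Fin p)) fun i => f i = true
      refine lt_of_le_of_ne h1 fun h => hf ⟨true, funext fun i => ?_⟩
      have h2 : (Finset.univ.filter fun i => f i = true) = Finset.univ := by
        rw [← Finset.card_eq_iff_eq_univ, Fintype.card_fin, ← hn, h]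
      have := h2.symm ▸ Finset.mem_univ i
      simpa using this
    have hg : Nat.gcd n p = 1 := (Nat.coprime_comm.1
      ((Nat.Prime.coprime_iff_not_dvd hp).2 fun h => absurd (Nat.le_of_dvd hn0 h) (by omega)))
    have hb := Nat.gcd_eq_gcd_ab n p
    rw [hg] at hb
    simp only [boolWeight, h0, if_false, hcard, zero_add]
    rw [Finset.sum_add_distrib, ← Finset.sum_filter, Finset.sum_const, Finset.sum_const, ← hn]
    simp only [Finset.card_univ, Fintype.card_fin, nsmul_eq_mul]
    push_cast at hb
    linarith

/-- Exchanging the two letters gives a second orbit weight; comparing it with the first is what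
makes `cyclicDefect` symmetric. -/
theorem IsOrbitWeight.comp_not {W : (Fin p → Bool) → ℤ} (hW : IsOrbitWeight W) :
    IsOrbitWeight fun f : Fin p → Bool => W fun i => !f i where
  const a := hW.const _
  sum_rotate f hf := hW.sum_rotate (fun i => !f i) (by
    rintro ⟨a, ha⟩
    exact hf ⟨!a, funext fun i => by simp [← congrFun ha i]⟩)

/-- Two letters suffice: mark the positions where the word attains its minimum. The marking commutes
with rotation, and it is constant only if the word is. -/
theorem exists_isOrbitWeight (A : Type*) [LinearOrder A] :
    ∃ W : (Fin p → A) → ℤ, IsOrbitWeight W := by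
  classical
  have hne : (Finset.univ : Finset (Fin p)).Nonempty := ⟨0, Finset.mem_univ _⟩
  refine ⟨fun f => boolWeight fun i => decide (f i = Finset.univ.inf' hne f), ⟨fun a => ?_, ?_⟩⟩
  · simp only [Finset.inf'_const, decide_true]
    exact isOrbitWeight_boolWeight.const _
  · intro f hf
    have h1 : ∀ k : Fin p, (Finset.univ.inf' hne fun i => f (i + k)) = Finset.univ.inf' hne f := by
      intro k
      refine le_antisymm (Finset.le_inf' _ _ fun i _ => ?_) (Finset.le_inf' _ _ fun i _ => ?_)
      · exact (Finset.inf'_le (fun i => f (i + k)) (Finset.mem_univ (i - k))).trans (by simp)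
      · exact Finset.inf'_le f (Finset.mem_univ (i + k))
    simp only [h1]
    refine isOrbitWeight_boolWeight.sum_rotate
      (fun i => decide (f i = Finset.univ.inf' hne f)) ?_
    rintro ⟨a, ha⟩
    obtain ⟨j, -, hj⟩ := Finset.exists_mem_eq_inf' hne f
    have haj := congrFun ha j
    rw [hj] at ha haj
    refine hf ⟨f j, funext fun i => ?_⟩
    have := congrFun ha i
    simp only [decide_true] at haj
    rw [← haj] at this
    simpa using this

theorem not_const_iff {f : Fin p → A} :
    (¬∃ a, f = fun _ => a) ↔ ∃ i, f i ≠ f 0 := by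
  constructor
  · intro h
    by_contra h'
    push Not at h'
    exact h ⟨f 0, funext h'⟩
  · rintro ⟨i, hi⟩ ⟨a, rfl⟩
    exact hi rfl

/-- The orbit weight on words in three letters which underlies `(x₀ + x₁) + x₂`. -/
theorem IsOrbitWeight.left_assoc {W : (Fin p → Bool) → ℤ} (hW : IsOrbitWeight W) :
    IsOrbitWeight fun f : Fin p → Fin 3 =>
      (if ∀ i, f i = 0 ∨ f i = 1 then W (fun i => decide (f i = 0)) else 0) +
        W (fun i => decide (f i = 0 ∨ f i = 1)) where
  const a := by simp [hW.const]
  sum_rotate f hf := by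
    have h1 : ∀ k : Fin p, (∀ i, f (i + k) = 0 ∨ f (i + k) = 1) ↔ ∀ i, f i = 0 ∨ f i = 1 :=
      fun k => ⟨fun h i => by simpa using h (i - k), fun h i => h _⟩
    simp only [h1, Finset.sum_add_distrib]
    -- A word in 0 and 1 becomes constant when these letters are merged, so only the first summand
    -- contributes. Otherwise the first summand is absent, and the merged word could be constant
    -- only if `f` were constantly 2.
    by_cases h : ∀ i, f i = 0 ∨ f i = 1
    · simp only [h, implies_true, if_true, decide_true, hW.const, Finset.sum_const_zero, add_zero]
      refine hW.sum_rotate (fun i => decide (f i = 0)) ?_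
      rw [not_const_iff] at hf ⊢
      obtain ⟨i, hi⟩ := hf
      refine ⟨i, ?_⟩
      rcases h i with h' | h' <;> rcases h 0 with h'' | h'' <;> simp_all
    · simp only [h, if_false, Finset.sum_const_zero, zero_add]
      refine hW.sum_rotate (fun i => decide (f i = 0 ∨ f i = 1)) ?_
      rintro ⟨a, ha⟩
      cases a with
      | true => exact h fun i => by simpa using congrFun ha i
      | false =>
        refine hf ⟨2, funext fun i => ?_⟩
        have := congrFun ha i
        simp only [decide_eq_false_iff_not] at this
        generalize f i = a at this
        fin_cases a <;> simp_all

/-- The orbit weight on words in three letters which underlies `x₀ + (x₁ + x₂)`. -/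
theorem IsOrbitWeight.right_assoc {W : (Fin p → Bool) → ℤ} (hW : IsOrbitWeight W) :
    IsOrbitWeight fun f : Fin p → Fin 3 => W (fun i => decide (f i = 0)) +
      (if ∀ i, f i = 1 ∨ f i = 2 then W (fun i => decide (f i = 1)) else 0) where
  const a := by simp [hW.const]
  sum_rotate f hf := by
    have h1 : ∀ k : Fin p, (∀ i, f (i + k) = 1 ∨ f (i + k) = 2) ↔ ∀ i, f i = 1 ∨ f i = 2 :=
      fun k => ⟨fun h i => by simpa using h (i - k), fun h i => h _⟩
    simp only [h1, Finset.sum_add_distrib]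
    by_cases h : ∀ i, f i = 1 ∨ f i = 2
    · have h0 : ∀ i, f i ≠ 0 := fun i => by rcases h i with h' | h' <;> rw [h'] <;> decide
      simp only [h, h0, implies_true, if_true, decide_false, hW.const, Finset.sum_const_zero,
        zero_add]
      refine hW.sum_rotate (fun i => decide (f i = 1)) ?_
      rw [not_const_iff] at hf ⊢
      obtain ⟨i, hi⟩ := hf
      refine ⟨i, ?_⟩
      rcases h i with h' | h' <;> rcases h 0 with h'' | h'' <;> simp_all
    · simp only [h, if_false, Finset.sum_const_zero, add_zero]
      refine hW.sum_rotate (fun i => decide (f i = 0)) ?_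
      rintro ⟨a, ha⟩
      cases a with
      | true => exact hf ⟨0, funext fun i => by simpa using congrFun ha i⟩
      | false =>
        refine h fun i => ?_
        have := congrFun ha i
        simp only [decide_eq_false_iff_not] at this
        generalize f i = a at this
        fin_cases a <;> simp_all

end Weights

/-! ### Powers of the rotation, traces and invariant `p`-th powers. -/

section Trace

set_option linter.unusedSectionVars false

variable {p : ℕ} [Fact p.Prime] {R : Type u} [CommRing R]
  {V W : Type u} [AddCommGroup V] [Module R V] [AddCommGroup W] [Module R W]

theorem finRotate_symm_apply_eq (i : Fin p) : (finRotate p).symm i = i - 1 := by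
  rw [Equiv.symm_apply_eq, finRotate_apply, sub_add_cancel]

theorem sigma_pow_tprod (k : Fin p) (v : Fin p → V) :
    (sigma p R V ^ (k : ℕ)) (PiTensorProduct.tprod R v) =
      PiTensorProduct.tprod R fun i => v (i - k) := by
  have h : ∀ n : ℕ, ∀ v : Fin p → V, (sigma p R V ^ n) (PiTensorProduct.tprod R v) =
      PiTensorProduct.tprod R fun i => v (i - Fin.ofNat p n) := by
    intro n
    induction n with
    | zero =>
      intro v
      simp
    | succ n ih =>
      intro v
      have h1 : Fin.ofNat p (n + 1) = Fin.ofNat p n + 1 := by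
        ext
        simp [Fin.val_add]
      rw [pow_succ', Module.End.mul_apply, ih, sigma_tprod]
      congr 1
      funext i
      rw [finRotate_symm_apply_eq, h1, sub_sub, add_comm]
  rw [h, Fin.ofNat_val_eq_self]

theorem traceEnd_apply (x : ⨂[R]^p V) :
    traceEnd p R V x = ∑ k : Fin p, (sigma p R V ^ (k : ℕ)) x := by
  rw [traceEnd, LinearMap.sum_apply, Finset.sum_range fun k => (sigma p R V ^ k) x]

theorem coinv_mk_sigma (x : ⨂[R]^p V) :
    (Submodule.Quotient.mk (sigma p R V x) : Coinv p R V) = Submodule.Quotient.mk x :=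
  Eq.symm ((Submodule.Quotient.eq _).2 ⟨x, rfl⟩)

theorem coinv_mk_sigma_pow (n : ℕ) (x : ⨂[R]^p V) :
    (Submodule.Quotient.mk ((sigma p R V ^ n) x) : Coinv p R V) = Submodule.Quotient.mk x := by
  induction n with
  | zero => rfl
  | succ n ih => rw [pow_succ', Module.End.mul_apply, coinv_mk_sigma, ih]

theorem sigma_inv (x : Inv p R V) : sigma p R V x = x := by
  have h : (x : ⨂[R]^p V) - sigma p R V x = 0 := x.2
  exact (sub_eq_zero.1 h).symm

theorem sigma_pow_inv (n : ℕ) (x : Inv p R V) : (sigma p R V ^ n) x = x := by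
  induction n with
  | zero => rfl
  | succ n ih => rw [pow_succ', Module.End.mul_apply, ih, sigma_inv]

theorem trace_mk_coe (x : ⨂[R]^p V) :
    (trace p R V (Submodule.Quotient.mk x) : ⨂[R]^p V) = traceEnd p R V x := rfl

/-- The class in `(V^{⊗ p})_σ` of a trace vanishes. -/
theorem coinv_mk_traceEnd (hR : (p : R) = 0) (x : ⨂[R]^p V) :
    (Submodule.Quotient.mk (traceEnd p R V x) : Coinv p R V) = 0 := by
  rw [traceEnd_apply, ← Submodule.mkQ_apply, map_sum]
  simp only [Submodule.mkQ_apply, coinv_mk_sigma_pow]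
  simp only [Finset.sum_const, Finset.card_univ, Fintype.card_fin]
  exact nsmul_eq_zero_of hR _

variable (p V) in
/-- The invariant element `v ⊗ ⋯ ⊗ v`. -/
noncomputable def powInv (R : Type u) [CommRing R] [Module R V] (v : V) : Inv p R V :=
  ⟨PiTensorProduct.tprod R fun _ => v, by
    change PiTensorProduct.tprod R (fun _ => v) - sigma p R V _ = 0
    rw [sigma_tprod, sub_self]⟩

theorem powFun_powInv (f : V →ₗ[R] R) (v : V) : powFun p f (powInv p V R v) = f v ^ p := by
  refine (powFun_tprod p f _).trans ?_
  simp

end Trace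

/-! ### Invariants and coinvariants of tensor powers of free modules. -/

section Free

variable {p : ℕ} [Fact p.Prime] {R : Type u} [CommRing R]

/-- On the `p`-th tensor power of a free module, the identity is the sum of a trace and of the
projection to the diagonal. -/
theorem exists_contraction (p : ℕ) [Fact p.Prime] (R : Type u) [CommRing R] (n : ℕ) :
    ∃ h : (⨂[R]^p (Fin n → R)) →ₗ[R] (⨂[R]^p (Fin n → R)), ∀ x,
      x = (∑ k : Fin p, (sigma p R _ ^ (k : ℕ)) (h ((sigma p R _ ^ ((-k : Fin p) : ℕ)) x))) +
        ∑ a : Fin n, powFun p (LinearMap.proj a) x •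
          PiTensorProduct.tprod R fun _ => Pi.single a (1 : R) := by
  classical
  obtain ⟨W, hW⟩ := exists_isOrbitWeight (p := p) (Fin n)
  let B := Basis.piTensorProduct (R := R) fun _ : Fin p => Pi.basisFun R (Fin n)
  have hB : ∀ f, B f = PiTensorProduct.tprod R fun i => Pi.single (f i) (1 : R) := by
    intro f
    simp [B, Basis.piTensorProduct_apply]
  have hσ : ∀ (k : Fin p) f, (sigma p R _ ^ (k : ℕ)) (B f) = B fun i => f (i - k) := by
    intro k f
    rw [hB, sigma_pow_tprod, hB]
  -- On a basis tensor indexed by `f`, the operator `∑ σ^k h σ^{-k}` is multiplication by the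
  -- rotation sum of `W` at `f`: 1 for nonconstant `f` and 0 for constant `f`. The diagonal
  -- projection supplies the constant words.
  let h := B.constr R fun f => (W f : R) • B f
  have hh : ∀ f, h (B f) = (W f : R) • B f := fun f => B.constr_basis R _ f
  refine ⟨h, fun x => ?_⟩
  let P : (⨂[R]^p (Fin n → R)) →ₗ[R] (⨂[R]^p (Fin n → R)) :=
    (∑ k : Fin p, (sigma p R _ ^ (k : ℕ)) ∘ₗ h ∘ₗ (sigma p R _ ^ ((-k : Fin p) : ℕ))) +
      ∑ a : Fin n, (powFun p (LinearMap.proj a)).smulRight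
        (PiTensorProduct.tprod R fun _ => Pi.single a (1 : R))
  have hP : P = LinearMap.id := by
    refine B.ext fun f => ?_
    have h1 : ∀ a : Fin n, powFun p (LinearMap.proj a : (Fin n → R) →ₗ[R] R) (B f) =
        if f = fun _ => a then 1 else 0 := by
      intro a
      rw [hB, powFun_tprod]
      simp only [LinearMap.proj_apply, Pi.single_apply, Finset.prod_ite_zero, Finset.prod_const_one,
        Finset.mem_univ, true_implies]
      congr 1
      exact propext ⟨fun h => funext fun i => (h i).symm, fun h i => by rw [h]⟩
    have h2 : ∀ a : Fin n, powFun p (LinearMap.proj a : (Fin n → R) →ₗ[R] R) (B f) •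
        (PiTensorProduct.tprod R fun _ => Pi.single (M := fun _ => R) a (1 : R)) =
          if f = fun _ => a then B f else 0 := by
      intro a
      rw [h1]
      split_ifs with hf
      · rw [one_smul, hB, hf]
      · rw [zero_smul]
    simp only [P, LinearMap.add_apply, LinearMap.sum_apply, LinearMap.comp_apply, hσ, hh,
      map_smul, LinearMap.smulRight_apply, h2, sub_neg_eq_add, sub_add_cancel, LinearMap.id_apply]
    rw [← Finset.sum_smul, ← Int.cast_sum, hW.sum_rotate_eq]
    split_ifs with hf
    · obtain ⟨a, rfl⟩ := hf
      have hp : p ≠ 0 := (Fact.out : p.Prime).ne_zero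
      have : ∀ b, ((fun _ : Fin p => a) = fun _ => b) ↔ a = b := fun b =>
        ⟨fun h => congrFun h 0, fun h => by rw [h]⟩
      simp [this]
    · rw [Int.cast_one, one_smul, Finset.sum_eq_zero, add_zero]
      intro a _
      rw [if_neg fun h => hf ⟨a, h⟩]
  have := LinearMap.congr_fun hP x
  simpa [P] using this.symm

/-- An invariant element of the `p`-th tensor power of a free module is the sum of a trace and of
`p`-th powers. -/
theorem exists_eq_trace_add_free (n : ℕ) (x : Inv p R (Fin n → R)) :
    ∃ y : Coinv p R (Fin n → R), x = trace p R (Fin n → R) y +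
      ∑ a : Fin n, powFun p (LinearMap.proj a) (x : ⨂[R]^p (Fin n → R)) • powInv p _ R (Pi.single a 1) := by
  obtain ⟨h, hh⟩ := exists_contraction p R n
  refine ⟨Submodule.Quotient.mk (h x), Subtype.ext ?_⟩
  have h1 := hh x
  -- The inner powers of `σ` fix the invariant element `x`, so the first sum is the trace of `h x`.
  simp only [sigma_pow_inv] at h1
  rw [Submodule.coe_add, trace_mk_coe, traceEnd_apply]
  simpa [powInv] using h1

/-- An element of the cyclic power of a free module with trace zero is a combination of
`p`-th powers. -/
theorem exists_eq_sum_powClass_free (n : ℕ) (x : Coinv p R (Fin n → R))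
    (hx : trace p R (Fin n → R) x = 0) :
    ∃ c : Fin n → R, x = ∑ a : Fin n, c a • powClass p R _ (Pi.single a 1) := by
  obtain ⟨h, hh⟩ := exists_contraction p R n
  obtain ⟨x, rfl⟩ := Submodule.Quotient.mk_surjective _ x
  have hx' : traceEnd p R (Fin n → R) x = 0 := congrArg Subtype.val hx
  refine ⟨fun a => powFun p (LinearMap.proj a) x, ?_⟩
  -- In the coinvariants it is the outer powers of `σ` that disappear. What remains of the first sum
  -- is the class of `h` applied to `∑ σ^{-k} x`, the trace of `x`, which is zero.
  have h1 := congrArg (LinearMap.range (oneSubSigma p R (Fin n → R))).mkQ (hh x)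
  rw [map_add, map_sum, map_sum] at h1
  simp only [Submodule.mkQ_apply, coinv_mk_sigma_pow] at h1
  have h2 : ∑ k : Fin p, (sigma p R _ ^ ((-k : Fin p) : ℕ)) x = 0 := by
    rw [← hx', traceEnd_apply,
      ← Equiv.sum_comp (Equiv.neg (Fin p)) fun k => (sigma p R _ ^ (k : ℕ)) x]
    rfl
  simp only [← Submodule.mkQ_apply] at h1
  rw [← map_sum, ← map_sum, h2, map_zero, map_zero, zero_add] at h1
  simpa [powClass] using h1

end Free

/-! ### Exactness of the trace complex for projective modules. -/

section Exactness

set_option linter.unusedSectionVars false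

variable {p : ℕ} [Fact p.Prime] {R : Type u} [CommRing R] (hR : (p : R) = 0)
  {V W : Type u} [AddCommGroup V] [Module R V]

theorem psi_tmul (r : R) (v : V) :
    psi hR V (toTwist hR R r ⊗ₜ[R] v) = toTwist hR _ (r • powClass p R V v) := rfl

theorem frobMap_apply (v : V) : frobMap hR V v = toTwist hR R 1 ⊗ₜ[R] v := rfl

/-- The functional `f^{⊗ p}` on the cyclic power. -/
noncomputable def coinvFun (p : ℕ) {R : Type u} [CommRing R] {V : Type u} [AddCommGroup V]
    [Module R V] (f : V →ₗ[R] R) : Coinv p R V →ₗ[R] R :=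
  Submodule.liftQ _ (powFun p f) (by
    rintro _ ⟨x, rfl⟩
    change powFun p f (x - sigma p R V x) = 0
    rw [map_sub, powFun_sigma, sub_self])

/-- Every functional `f^{(1)}` factors through `ψ`. As these functionals separate the points of
`V^{(1)}`, injectivity of `ψ` follows. -/
theorem twistMap_coinvFun_psi (f : V →ₗ[R] R) (y : VTwist hR V) :
    twistMap hR (coinvFun p f) (psi hR V y) = twistFun hR f y := by
  induction y using TensorProduct.induction_on with
  | zero => simp
  | add y z hy hz => simp only [map_add, hy, hz]
  | tmul r v =>
    obtain ⟨r, rfl⟩ := (toTwist hR R).surjective r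
    rw [twistFun_tmul, psi_tmul]
    have h : coinvFun p f (r • powClass p R V v) = f v ^ p * r := by
      rw [map_smul, smul_eq_mul, mul_comm]
      congr 1
      exact (powFun_tprod p f fun _ => v).trans (by simp)
    exact congrArg (toTwist hR R) h

theorem psi_injective [Module.Finite R V] [Module.Projective R V] :
    Function.Injective (psi hR V) := by
  intro y z h
  refine twistFun_ext hR fun f => ?_
  rw [← twistMap_coinvFun_psi, h, twistMap_coinvFun_psi]

theorem psiHat_powInv [Module.Finite R V] [Module.Projective R V] (v : V) :
    psiHat hR V (toTwist hR _ (powInv p V R v)) = frobMap hR V v := by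
  refine twistFun_ext hR fun f => ?_
  rw [twistFun_psiHat, frobMap_apply, twistFun_tmul, powFun_powInv, mul_one]

theorem psiHat_smul_powInv [Module.Finite R V] [Module.Projective R V] (r : R) (v : V) :
    psiHat hR V (toTwist hR _ (r • powInv p V R v)) = toTwist hR R r ⊗ₜ[R] v := by
  refine twistFun_ext hR fun f => ?_
  rw [twistFun_psiHat, twistFun_tmul]
  have : powFun p f ((r • powInv p V R v : Inv p R V) : ⨂[R]^p V) = r * f v ^ p := by
    rw [Submodule.coe_smul, map_smul, powFun_powInv, smul_eq_mul]
  rw [this, mul_comm]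

theorem invMap_trace {W : Type u} [AddCommGroup W] [Module R W] (g : V →ₗ[R] W)
    (x : Coinv p R V) : invMap p g (trace p R V x) = trace p R W (coinvMap p g x) :=
  (trace_coinvMap p g x).symm

theorem invMap_powInv {W : Type u} [AddCommGroup W] [Module R W] (g : V →ₗ[R] W) (v : V) :
    invMap p g (powInv p V R v) = powInv p W R (g v) :=
  Subtype.ext (PiTensorProduct.map_tprod (fun _ => g) (fun _ => v))

theorem coinvMap_powClass {W : Type u} [AddCommGroup W] [Module R W] (g : V →ₗ[R] W) (v : V) :
    coinvMap p g (powClass p R V v) = powClass p R W (g v) :=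
  congrArg Submodule.Quotient.mk (PiTensorProduct.map_tprod (fun _ => g) (fun _ => v))

variable [Module.Finite R V] [Module.Projective R V]

/-- An invariant element is the sum of a trace and of a combination of `p`-th powers. -/
theorem exists_eq_trace_add (x : Inv p R V) :
    ∃ (y : Coinv p R V) (n : ℕ) (c : Fin n → R) (v : Fin n → V),
      x = trace p R V y + ∑ a : Fin n, c a • powInv p _ R (v a) ∧
      ((∀ f : V →ₗ[R] R, powFun p f x = 0) → ∀ a, c a = 0) := by
  -- `V` is a retract of a free module, so the decomposition is made there and carried back by `e`.
  -- Its coefficients are values at `x` of `f^{⊗p}` for the coordinate functionals `f` of `g`, hence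
  -- the vanishing clause.
  obtain ⟨n, e, g, -, -, heg⟩ := Module.Finite.exists_comp_eq_id_of_projective R V
  obtain ⟨y, hy⟩ := exists_eq_trace_add_free n (invMap p g x)
  refine ⟨coinvMap p e y, n, fun a => powFun p (LinearMap.proj a) (invMap p g x : ⨂[R]^p (Fin n → R)),
    fun a => e (Pi.single a 1), ?_, fun hf a => ?_⟩
  · have hx : invMap p e (invMap p g x) = x := by
      refine Subtype.ext ?_
      change powMap p e (powMap p g x) = x
      rw [← powMap_comp, heg, powMap_id]
    have := congrArg (invMap p e) hy
    rw [hx, map_add, map_sum, invMap_trace] at this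
    simpa only [map_smul, invMap_powInv] using this
  · exact (powFun_powMap p _ g x).trans (hf _)

/-- The kernel of `ψ̂` is the image of the trace map. -/
theorem exists_trace_eq_of_psiHat_eq_zero (x : Inv p R V)
    (hx : psiHat hR V (toTwist hR _ x) = 0) : ∃ y, trace p R V y = x := by
  obtain ⟨y, n, c, v, h, hc⟩ := exists_eq_trace_add x
  have hc' : ∀ a, c a = 0 := hc fun f => by
    have := twistFun_psiHat hR f x
    rw [hx, map_zero] at this
    exact ((toTwist hR R).map_eq_zero_iff.1 this.symm)
  refine ⟨y, ?_⟩
  rw [h]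
  simp [hc']

/-- The class of an invariant element `x` in `(V^{⊗ p})_σ` is `ψ (ψ̂ x)`. -/
theorem psi_psiHat (x : Inv p R V) :
    psi hR V (psiHat hR V (toTwist hR _ x)) =
      toTwist hR _ (Submodule.Quotient.mk (x : ⨂[R]^p V)) := by
  -- It is enough to compare the two sides on traces, where both vanish because `p = 0`, and on
  -- multiples of `v^{⊗p}`.
  obtain ⟨y, n, c, v, h, -⟩ := exists_eq_trace_add x
  obtain ⟨y, rfl⟩ := Submodule.Quotient.mk_surjective _ y
  rw [h]
  rw [map_add, map_add, psiHat_trace, zero_add, map_sum, map_sum, map_sum]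
  simp only [psiHat_smul_powInv, psi_tmul]
  rw [← map_sum]
  congr 1
  rw [Submodule.coe_add, trace_mk_coe, Submodule.Quotient.mk_add, coinv_mk_traceEnd hR, zero_add,
    ← Submodule.mkQ_apply, Submodule.coe_sum, map_sum]
  rfl

/-- The kernel of the trace map is the image of `ψ`. -/
theorem exists_psi_eq_of_trace_eq_zero (x : Coinv p R V) (hx : trace p R V x = 0) :
    ∃ y, psi hR V y = toTwist hR _ x := by
  obtain ⟨n, e, g, -, -, heg⟩ := Module.Finite.exists_comp_eq_id_of_projective R V
  obtain ⟨c, hc⟩ := exists_eq_sum_powClass_free n (coinvMap p g x) (by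
    rw [trace_coinvMap, hx, map_zero])
  have hx : coinvMap p e (coinvMap p g x) = x := by
    obtain ⟨x, rfl⟩ := Submodule.Quotient.mk_surjective _ x
    change Submodule.Quotient.mk (powMap p e (powMap p g x)) = _
    rw [← powMap_comp, heg, powMap_id]
  refine ⟨∑ a, toTwist hR R (c a) ⊗ₜ[R] e (Pi.single a 1), ?_⟩
  have h := congrArg (coinvMap p e) hc
  rw [hx, map_sum] at h
  simp only [map_smul, coinvMap_powClass] at h
  rw [h, map_sum, map_sum]
  rfl

end Exactness

/-! ### Comparison of square-zero extensions through multiplicative sections. -/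

section SquareZero

variable {R : Type u} [CommRing R] {M : Type v} [AddCommGroup M] [Module R M]
  {A : Type w} [Ring A] {A' : Type*} [Ring A']

/-- Two square-zero extensions which have multiplicative sections with the same additive defect are
isomorphic. -/
theorem IsSquareZeroExtension.exists_ringEquiv {i : M →+ A} {q : A →+* R} {i' : M →+ A'}
    {q' : A' →+* R} (h : IsSquareZeroExtension i q) (h' : IsSquareZeroExtension i' q')
    (T : R →* A) (T' : R →* A') (hT : ∀ r, q (T r) = r) (hT' : ∀ r, q' (T' r) = r)
    (κ : R → R → M) (hκ : ∀ r s, T (r + s) = T r + T s + i (κ r s))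
    (hκ' : ∀ r s, T' (r + s) = T' r + T' s + i' (κ r s)) :
    ∃ e : A ≃+* A', (∀ m, e (i m) = i' m) ∧ ∀ x, q' (e x) = q x := by
  have hqi : ∀ m, q (i m) = 0 := fun m => (h.exact _).2 ⟨m, rfl⟩
  have hqi' : ∀ m, q' (i' m) = 0 := fun m => (h'.exact _).2 ⟨m, rfl⟩
  have hc : ∀ x, ∃ m, x = T (q x) + i m := by
    intro x
    obtain ⟨m, hm⟩ := (h.exact (x - T (q x))).1 (by rw [map_sub, hT, sub_self])
    exact ⟨m, by rw [hm, add_sub_cancel]⟩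
  choose c hc using hc
  have hc' : ∀ r m, c (T r + i m) = m := by
    intro r m
    have := hc (T r + i m)
    rw [map_add, hT, hqi, add_zero] at this
    exact (h.injective (add_left_cancel this)).symm
  -- Every `x` is uniquely `T (q x) + i (c x)`; the isomorphism exchanges the two sections and keeps
  -- the coordinates.
  let E : A → A' := fun x => T' (q x) + i' (c x)
  have hE : ∀ r m, E (T r + i m) = T' r + i' m := by
    intro r m
    change T' (q _) + i' (c _) = _
    rw [hc', map_add, hT, hqi, add_zero]
  -- `T 0` is not assumed to vanish. The defect at `(0, 0)` forces `T 0 = -i (κ 0 0)`, and likewise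
  -- for `T'`, so the corrections cancel.
  have hEi : ∀ m, E (i m) = i' m := by
    intro m
    have h0 := hκ 0 0
    have h0' := hκ' 0 0
    rw [add_zero] at h0 h0'
    have h1 : T 0 = -i (κ 0 0) := by
      rw [eq_neg_iff_add_eq_zero]
      exact add_left_cancel (a := T 0) (by rw [← add_assoc, ← h0, add_zero])
    have h1' : T' 0 = -i' (κ 0 0) := by
      rw [eq_neg_iff_add_eq_zero]
      exact add_left_cancel (a := T' 0) (by rw [← add_assoc, ← h0', add_zero])
    have h2 : i m = T 0 + i (m + κ 0 0) := by rw [h1, map_add]; abel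
    rw [h2, hE, h1', map_add]
    abel
  have hadd : ∀ x y, E (x + y) = E x + E y := by
    intro x y
    have h1 : x + y = T (q x + q y) + i (c x + c y - κ (q x) (q y)) := by
      rw [hκ, map_sub, map_add]
      nth_rewrite 1 [hc x, hc y]
      abel
    rw [h1, hE, hκ', map_sub, map_add]
    simp only [E]
    abel
  have hmul : ∀ x y, E (x * y) = E x * E y := by
    intro x y
    have h1 : x * y = T (q x * q y) + i (q x • c y + q y • c x) := by
      nth_rewrite 1 [hc x, hc y]
      rw [map_mul, map_add, mul_add, add_mul, add_mul, h.sq_zero, h.left_mul, h.right_mul, hT, hT]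
      abel
    rw [h1, hE]
    simp only [E]
    rw [map_mul, map_add, mul_add, add_mul, add_mul, h'.sq_zero, h'.left_mul, h'.right_mul, hT',
      hT']
    abel
  have hone : E 1 = 1 := by
    have h1 : (1 : A) = T 1 + i 0 := by rw [map_one, map_zero, add_zero]
    rw [h1, hE, map_one, map_zero, add_zero]
  have hzero : E 0 = 0 := by simpa using hEi 0
  have hq : ∀ x, q' (E x) = q x := by
    intro x
    change q' (T' (q x) + i' (c x)) = _
    rw [map_add, hT', hqi', add_zero]
  let F : A →+* A' :=
    { toFun := E, map_one' := hone, map_mul' := hmul, map_zero' := hzero, map_add' := hadd }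
  refine ⟨RingEquiv.ofBijective F ⟨?_, fun x => ?_⟩, hEi, hq⟩
  · rw [injective_iff_map_eq_zero]
    intro x (hx : E x = 0)
    obtain ⟨m, rfl⟩ := (h.exact x).1 (by rw [← hq, hx, map_zero])
    rw [hEi] at hx
    rw [h'.injective (hx.trans (map_zero i').symm), map_zero]
  · obtain ⟨m, hm⟩ := (h'.exact (x - T' (q' x))).1 (by rw [map_sub, hT', sub_self])
    exact ⟨T (q' x) + i m, (hE _ _).trans (by rw [hm, add_sub_cancel])⟩

end SquareZero

/-! ### The additive defect of Teichmüller lifts in second Witt vectors. -/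

section Witt

variable {p : ℕ} [Fact p.Prime] {R : Type u} [CommRing R]

/-- The value at `(r, s)` of the integral polynomial `((r + s) ^ p - r ^ p - s ^ p) / p`. -/
def powDefect (p : ℕ) [Fact p.Prime] {R : Type*} [CommRing R] (r s : R) : R :=
  ∑ f : Fin p → Bool, (boolWeight f : R) * ∏ i, cond (f i) r s

/-- A product of scalars is unchanged when its factors are rotated, so summing over all rotations
multiplies the weighted sum by `p`; the result is the sum over the nonconstant words in `r` and `s`.
-/
theorem mul_powDefect {R : Type*} [CommRing R] (r s : R) :
    p * powDefect p r s = (r + s) ^ p - r ^ p - s ^ p := by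
  have h := isOrbitWeight_boolWeight.sum_sum_rotate (R := R) (p := p)
    fun f : Fin p → Bool => ∏ i, cond (f i) r s
  have h1 : ∀ (k : Fin p) (f : Fin p → Bool),
      ∏ i, cond (f (i - k)) r s = ∏ i, cond (f i) r s := fun k f =>
    Equiv.prod_comp (Equiv.subRight k) fun i => cond (f i) r s
  have h2 : (r + s) ^ p = ∑ f : Fin p → Bool, ∏ i, cond (f i) r s := by
    rw [← Fintype.sum_pow (fun b : Bool => cond b r s), Fintype.sum_bool, cond_true, cond_false]
  simp only [h1, smul_eq_mul, Finset.sum_const, Finset.card_univ, Fintype.card_fin, nsmul_eq_mul,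
    Fintype.sum_bool, cond_true, cond_false, Finset.prod_const] at h
  rw [powDefect, h, h2, sub_sub]

theorem map_powDefect {R S : Type*} [CommRing R] [CommRing S] (φ : R →+* S) (r s : R) :
    φ (powDefect p r s) = powDefect p (φ r) (φ s) := by
  simp only [powDefect, map_sum, map_mul, map_intCast, map_prod]
  refine Finset.sum_congr rfl fun f _ => ?_
  congr 1
  exact Finset.prod_congr rfl fun i _ => by cases f i <;> rfl

/-- Over the integral polynomial ring the ghost component of index 1 of the difference `z` reads
`z₀^p + p z₁ = (x+y)^p - x^p - y^p`. There `z₀ = 0` and `p` can be cancelled. The general case is a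
specialisation of the two variables. -/
theorem coeff_teichmuller_add {R : Type*} [CommRing R] (r s : R) :
    (WittVector.teichmuller p (r + s) - WittVector.teichmuller p r -
      WittVector.teichmuller p s).coeff 0 = 0 ∧
    (WittVector.teichmuller p (r + s) - WittVector.teichmuller p r -
      WittVector.teichmuller p s).coeff 1 = powDefect p r s := by
  have key : ∀ x y : MvPolynomial Bool ℤ,
      (WittVector.teichmuller p (x + y) - WittVector.teichmuller p x -
        WittVector.teichmuller p y).coeff 0 = 0 ∧
      (WittVector.teichmuller p (x + y) - WittVector.teichmuller p x -
        WittVector.teichmuller p y).coeff 1 = powDefect p x y := by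
    intro x y
    generalize hz : WittVector.teichmuller p (x + y) - WittVector.teichmuller p x -
        WittVector.teichmuller p y = z
    have h0 : z.coeff 0 = 0 := by
      change WittVector.constantCoeff z = 0
      rw [← hz, map_sub, map_sub]
      change (WittVector.teichmuller p (x + y)).coeff 0 - (WittVector.teichmuller p x).coeff 0 -
        (WittVector.teichmuller p y).coeff 0 = 0
      simp only [WittVector.teichmuller_coeff_zero]
      ring
    refine ⟨h0, ?_⟩
    have h1 := congrArg (WittVector.ghostComponent 1) hz
    rw [map_sub, map_sub] at h1
    simp only [WittVector.ghostComponent_teichmuller, pow_one] at h1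
    rw [← mul_powDefect, WittVector.ghostComponent_apply, wittPolynomial_eq_sum_C_mul_X_pow] at h1
    have hp : (p : MvPolynomial Bool ℤ) ≠ 0 := by
      exact_mod_cast (Fact.out : p.Prime).ne_zero
    simp [Finset.sum_range_succ, h0, (Fact.out : p.Prime).ne_zero] at h1
    exact h1.symm
  let φ : MvPolynomial Bool ℤ →+* R :=
    MvPolynomial.eval₂Hom (Int.castRingHom R) fun b => cond b r s
  have hr : φ (MvPolynomial.X true) = r := by simp [φ]
  have hs : φ (MvPolynomial.X false) = s := by simp [φ]
  have hφ : WittVector.teichmuller p (r + s) - WittVector.teichmuller p r -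
      WittVector.teichmuller p s = WittVector.map φ (WittVector.teichmuller p
        (MvPolynomial.X true + MvPolynomial.X false) - WittVector.teichmuller p
        (MvPolynomial.X true) - WittVector.teichmuller p (MvPolynomial.X false)) := by
    rw [map_sub, map_sub, WittVector.map_teichmuller, WittVector.map_teichmuller,
      WittVector.map_teichmuller, map_add φ, hr, hs]
  obtain ⟨k0, k1⟩ := key (MvPolynomial.X true) (MvPolynomial.X false)
  rw [hφ, WittVector.map_coeff, WittVector.map_coeff, k0, k1, map_powDefect, hr, hs]
  exact ⟨map_zero φ, rfl⟩

variable (hR : (p : R) = 0)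

/-- The multiplicative section `r ↦ (r, 0)` of `W₂(R) → R`. -/
noncomputable def wittSection (p : ℕ) [Fact p.Prime] (R : Type u) [CommRing R] :
    R →* TruncatedWittVector p 2 R :=
  (WittVector.truncate 2 : WittVector p R →+* _).toMonoidHom.comp (WittVector.teichmuller p)

theorem truncate_eq_wittIncl (z : WittVector p R) (hz : z.coeff 0 = 0) :
    WittVector.truncate 2 z = wittIncl hR (toTwist hR R (z.coeff 1)) := by
  ext i
  rw [WittVector.coeff_truncate]
  fin_cases i
  · exact hz
  · rfl

theorem wittProj_truncate (z : WittVector p R) :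
    wittProj p R (WittVector.truncate 2 z) = z.coeff 0 :=
  WittVector.coeff_truncate _ _

theorem wittProj_wittSection (r : R) : wittProj p R (wittSection p R r) = r :=
  (wittProj_truncate _).trans (WittVector.teichmuller_coeff_zero p r)

theorem wittSection_add (r s : R) : wittSection p R (r + s) =
    wittSection p R r + wittSection p R s + wittIncl hR (toTwist hR R (powDefect p r s)) := by
  obtain ⟨h0, h1⟩ := coeff_teichmuller_add (p := p) r s
  rw [← h1, ← truncate_eq_wittIncl hR _ h0, map_sub, map_sub]
  change WittVector.truncate 2 (WittVector.teichmuller p (r + s)) =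
    WittVector.truncate 2 (WittVector.teichmuller p r) +
      WittVector.truncate 2 (WittVector.teichmuller p s) + _
  abel

theorem coeff_frobenius_zero (hR : (p : R) = 0) (z : WittVector p R) :
    (WittVector.frobenius z).coeff 0 = z.coeff 0 ^ p := by
  -- The zero ring satisfies `p = 0` but does not have characteristic `p`, so it is treated apart.
  rcases subsingleton_or_nontrivial R with h | h
  · exact Subsingleton.elim _ _
  · have : CharP R p := (CharP.charP_iff_prime_eq_zero Fact.out).2 hR
    exact WittVector.coeff_frobenius_charP p z 0

/-- The projection formula `V(m) x = V(m F(x))`, where in characteristic `p` the Frobenius `F`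
raises the zeroth coefficient to the power `p`. This is the source of the twisted module structure
on the kernel. -/
theorem wittIncl_mul (m : Twist hR R) (x : TruncatedWittVector p 2 R) :
    wittIncl hR m * x = wittIncl hR (wittProj p R x • m) := by
  obtain ⟨x, rfl⟩ := WittVector.truncate_surjective p 2 R x
  obtain ⟨m, rfl⟩ := (toTwist hR R).surjective m
  have h : ∀ z : WittVector p R, WittVector.truncate 2 (WittVector.verschiebung z) =
      wittIncl hR (toTwist hR R (z.coeff 0)) := fun z => by
    rw [truncate_eq_wittIncl hR _ (WittVector.verschiebung_coeff_zero z)]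
    rw [WittVector.verschiebung_coeff_succ z 0]
  have hm := h (WittVector.teichmuller p m)
  rw [WittVector.teichmuller_coeff_zero] at hm
  rw [← hm, ← map_mul, ← WittVector.verschiebung_mul_frobenius, h, WittVector.mul_coeff_zero,
    WittVector.teichmuller_coeff_zero, coeff_frobenius_zero hR, wittProj_truncate, smul_toTwist,
    mul_comm]
  rfl

theorem wittProj_wittIncl (m : Twist hR R) : wittProj p R (wittIncl hR m) = 0 := rfl

theorem isSquareZeroExtension_witt : IsSquareZeroExtension (wittIncl hR) (wittProj p R) where
  injective x y h := by
    have := congrArg (fun z => TruncatedWittVector.coeff 1 z) h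
    exact this
  exact x := by
    constructor
    · intro h
      refine ⟨toTwist hR R (x.coeff 1), ?_⟩
      ext i
      fin_cases i
      · exact h.symm
      · rfl
    · rintro ⟨m, rfl⟩
      rfl
  surjective r := ⟨_, wittProj_wittSection r⟩
  right_mul m x := wittIncl_mul hR m x
  left_mul m x := by rw [mul_comm, wittIncl_mul]
  sq_zero m m' := by rw [wittIncl_mul, wittProj_wittIncl, zero_smul, map_zero]

end Witt

/-! ### The cyclic-power sequence is an elementary extension. -/

section Elementary

variable {p : ℕ} [Fact p.Prime] {R : Type u} [CommRing R] (hR : (p : R) = 0)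

theorem RProj.subsingleton_of_isZero {V : RProj R} (h : Limits.IsZero V) :
    Subsingleton V.obj := by
  have h1 : (𝟙 V : V ⟶ V) = ⟨0⟩ := h.eq_of_src _ _
  have h2 : ∀ v : V.obj, v = 0 := fun v =>
    congrArg (fun f : V ⟶ V => f.hom.hom v) h1
  exact ⟨fun v w => (h2 v).trans (h2 w).symm⟩

theorem subsingleton_tensorPower (p : ℕ) [Fact p.Prime] (R : Type u) [CommRing R] (V : Type u)
    [AddCommGroup V] [Module R V] [Subsingleton V] : Subsingleton (⨂[R]^p V) := by
  have h : (LinearMap.id : (⨂[R]^p V) →ₗ[R] ⨂[R]^p V) = 0 := by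
    refine PiTensorProduct.ext (MultilinearMap.ext fun v => ?_)
    change PiTensorProduct.tprod R v = 0
    -- There is at least one tensor factor because `p > 0`; the empty tensor power of the zero
    -- module would be `R`.
    exact (PiTensorProduct.tprod R).map_coord_zero (0 : Fin p) (Subsingleton.elim _ _)
  exact ⟨fun x y => (LinearMap.congr_fun h x).trans (LinearMap.congr_fun h y).symm⟩

theorem subsingleton_coinv (p : ℕ) [Fact p.Prime] (R : Type u) [CommRing R] (V : Type u)
    [AddCommGroup V] [Module R V] [Subsingleton V] : Subsingleton (Coinv p R V) := by
  have := subsingleton_tensorPower p R V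
  exact (Submodule.Quotient.mk_surjective _).subsingleton

/-- The class of `(x, v)` in the fibre product. -/
noncomputable def fibreMk (V : RProj R) (x : Inv p R V.obj) (v : V.obj)
    (h : psiHat hR V.obj (toTwist hR _ x) = frobMap hR V.obj v) : fibre hR V :=
  ⟨(toTwist hR _ x, v), (mem_fibre hR).2 h⟩

theorem isElementaryExtension_cyclicExtension :
    (cyclicExtension hR).IsElementaryExtension where
  pointed₁ V hV := by
    have := RProj.subsingleton_of_isZero hV
    have h : Subsingleton (Twist hR (Coinv p R V.obj)) := subsingleton_coinv p R V.obj
    exact ModuleCat.isZero_of_subsingleton (ModuleCat.of R (Twist hR (Coinv p R V.obj)))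
  pointed₀ V hV := by
    have := RProj.subsingleton_of_isZero hV
    have := subsingleton_tensorPower p R V.obj
    have h1 : Subsingleton (Twist hR (Inv p R V.obj)) :=
      inferInstanceAs (Subsingleton (Inv p R V.obj))
    exact ModuleCat.isZero_of_subsingleton (ModuleCat.of R (fibre hR V))
  injective_b V := psi_injective hR
  exact_b_d V x := by
    constructor
    · intro h
      have h' : trace p R V.obj ((toTwist hR _).symm x) = 0 :=
        congrArg (fun y : fibre hR V => y.1.1) h
      exact exists_psi_eq_of_trace_eq_zero hR _ h'
    · rintro ⟨y, rfl⟩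
      exact Subtype.ext (Prod.ext (trace_psi hR y) rfl)
  exact_d_a V x := by
    constructor
    · intro (h : (x : fibre hR V).1.2 = 0)
      have h1 := (mem_fibre hR).1 (x : fibre hR V).2
      rw [h, map_zero] at h1
      obtain ⟨y, hy⟩ := exists_trace_eq_of_psiHat_eq_zero hR _ h1
      exact ⟨toTwist hR _ y, Subtype.ext (Prod.ext hy h.symm)⟩
    · rintro ⟨y, rfl⟩
      rfl
  surjective_a V v := ⟨fibreMk hR V (powInv p V.obj R v) v (psiHat_powInv (V := V.obj) hR v), rfl⟩

end Elementary

/-! ### The symmetric 2-cocycle of `p`-th tensor powers. -/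

section Defect

set_option linter.unusedSectionVars false

variable {p : ℕ} [Fact p.Prime] {R : Type u} [CommRing R]
  {V W : Type u} [AddCommGroup V] [Module R V] [AddCommGroup W] [Module R W]

theorem coinv_mk_tprod_rotate (k : Fin p) (v : Fin p → V) :
    (Submodule.Quotient.mk (PiTensorProduct.tprod R fun i => v (i + k)) : Coinv p R V) =
      Submodule.Quotient.mk (PiTensorProduct.tprod R v) := by
  rw [← coinv_mk_sigma_pow ((-k : Fin p) : ℕ) (PiTensorProduct.tprod R v), sigma_pow_tprod]
  simp only [sub_neg_eq_add]

/-- A tensor whose trace is `(v + w)^{⊗ p} - v^{⊗ p} - w^{⊗ p}`. -/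
noncomputable def powerDefect (p : ℕ) [Fact p.Prime] (R : Type u) [CommRing R] [Module R V]
    (v w : V) : ⨂[R]^p V :=
  ∑ f : Fin p → Bool, (boolWeight f : R) • PiTensorProduct.tprod R fun i => cond (f i) v w

/-- Expand the tensors whose factors are partial sums of `x` over two disjoint sets of letters. A
word `f` arises from exactly one two-letter word, recording which set each letter lies in, and from
none if some letter lies in neither. This rewrites defects of sums as weighted sums over a finer
alphabet. -/
theorem tprod_sum_sum {A : Type*} [Fintype A] [DecidableEq A] (U : (Fin p → Bool) → ℤ) (x : A → V)
    (P Q : A → Prop) [DecidablePred P] [DecidablePred Q] (hPQ : ∀ a, P a → ¬Q a) :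
    ∑ h : Fin p → Bool, (U h : R) • PiTensorProduct.tprod R (fun i => cond (h i)
        (∑ a, if P a then x a else 0) (∑ a, if Q a then x a else 0)) =
      ∑ f : Fin p → A, ((if ∀ i, P (f i) ∨ Q (f i) then U fun i => decide (P (f i)) else 0 : ℤ) : R) •
        PiTensorProduct.tprod R fun i => x (f i) := by
  classical
  have h1 : ∀ h : Fin p → Bool, PiTensorProduct.tprod R (fun i => cond (h i)
      (∑ a, if P a then x a else 0) (∑ a, if Q a then x a else 0)) =
      ∑ f : Fin p → A, if ∀ i, cond (h i) (P (f i)) (Q (f i)) then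
        PiTensorProduct.tprod R fun i => x (f i) else 0 := by
    intro h
    have h2 : (fun i => cond (h i) (∑ a, if P a then x a else 0) (∑ a, if Q a then x a else 0)) =
        fun i => ∑ a, if cond (h i) (P a) (Q a) then x a else 0 := by
      funext i
      cases h i <;> simp only [cond_true, cond_false] <;>
        exact Finset.sum_congr rfl fun a _ => by congr
    rw [h2, MultilinearMap.map_sum]
    refine Finset.sum_congr rfl fun f _ => ?_
    split_ifs with hf
    · congr 1
      funext i
      rw [if_pos (hf i)]
    · push Not at hf
      obtain ⟨i, hi⟩ := hf
      exact (PiTensorProduct.tprod R).map_coord_zero i (if_neg hi)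
  simp only [h1, Finset.smul_sum]
  rw [Finset.sum_comm]
  refine Finset.sum_congr rfl fun f _ => ?_
  split_ifs with hf
  · rw [Finset.sum_eq_single fun i => decide (P (f i))]
    · rw [if_pos]
      intro i
      rcases hf i with h | h
      · simp [h]
      · have h' : ¬P (f i) := fun h' => hPQ _ h' h
        simp [h, h']
    · intro h _ hne
      rw [if_neg, smul_zero]
      intro hh
      refine hne (funext fun i => ?_)
      have hi := hh i
      cases hb : h i with
      | true =>
        rw [hb] at hi
        exact (decide_eq_true (show P (f i) from hi)).symm
      | false =>
        rw [hb] at hi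
        exact (decide_eq_false fun h' => hPQ _ h' hi).symm
    · intro h
      exact absurd (Finset.mem_univ _) h
  · rw [Int.cast_zero, zero_smul]
    refine Finset.sum_eq_zero fun h _ => ?_
    rw [if_neg, smul_zero]
    intro hh
    refine hf fun i => ?_
    have hi := hh i
    cases hb : h i with
    | true => rw [hb] at hi; exact Or.inl hi
    | false => rw [hb] at hi; exact Or.inr hi

/-- The trace of the weighted sum is the sum over nonconstant words. All words together give
`(v+w)^{⊗p}`, and the two constant ones are the subtracted terms. -/
theorem traceEnd_powerDefect (v w : V) : traceEnd p R V (powerDefect p R v w) =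
    PiTensorProduct.tprod R (fun _ => v + w) - PiTensorProduct.tprod R (fun _ => v) -
      PiTensorProduct.tprod R (fun _ => w) := by
  have h := isOrbitWeight_boolWeight.sum_sum_rotate (R := R)
    fun f : Fin p → Bool => PiTensorProduct.tprod R fun i => cond (f i) v w
  have h1 : PiTensorProduct.tprod R (fun _ : Fin p => v + w) =
      ∑ f : Fin p → Bool, PiTensorProduct.tprod R fun i => cond (f i) v w := by
    rw [← (PiTensorProduct.tprod R).map_sum fun (_ : Fin p) (b : Bool) => cond b v w]
    simp
  rw [h1, sub_sub, traceEnd_apply]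
  simp only [powerDefect, map_sum, map_smul, sigma_pow_tprod]
  rw [h]
  simp

theorem powMap_powerDefect (g : V →ₗ[R] W) (v w : V) :
    powMap p g (powerDefect p R v w) = powerDefect p R (g v) (g w) := by
  simp only [powerDefect, map_sum, map_smul]
  refine Finset.sum_congr rfl fun f _ => ?_
  congr 1
  refine (PiTensorProduct.map_tprod _ _).trans ?_
  congr 1
  funext i
  cases f i <;> rfl

/-- Only the constant word in `v` avoids a zero factor, and its weight is zero. -/
theorem powerDefect_zero_right (v : V) : powerDefect p R v 0 = 0 := by
  refine Finset.sum_eq_zero fun f _ => ?_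
  by_cases hf : f = fun _ => true
  · rw [hf, isOrbitWeight_boolWeight.const, Int.cast_zero, zero_smul]
  · obtain ⟨i, hi⟩ : ∃ i, f i = false := by
      by_contra h
      push Not at h
      exact hf (funext fun i => by simpa using h i)
    rw [(PiTensorProduct.tprod R).map_coord_zero i (by rw [hi, cond_false]), smul_zero]

/-- The class of `powerDefect p R v w` in the cyclic power. -/
noncomputable def cyclicDefect (p : ℕ) [Fact p.Prime] (R : Type u) [CommRing R] [Module R V]
    (v w : V) : Coinv p R V :=
  Submodule.Quotient.mk (powerDefect p R v w)

theorem mk_sum_smul_tprod {A : Type*} [Fintype A] (U : (Fin p → A) → ℤ)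
    (G : (Fin p → A) → ⨂[R]^p V) :
    (Submodule.Quotient.mk (∑ f, (U f : R) • G f) : Coinv p R V) =
      ∑ f, (U f : R) • (Submodule.Quotient.mk (G f) : Coinv p R V) := by
  rw [← Submodule.mkQ_apply, map_sum]
  rfl

/-- In the coinvariants a pure tensor depends only on its word up to rotation, so the weight may be
replaced by the one with the letters exchanged. -/
theorem cyclicDefect_comm (v w : V) : cyclicDefect p R v w = cyclicDefect p R w v := by
  have h := isOrbitWeight_boolWeight.sum_eq (R := R) isOrbitWeight_boolWeight.comp_not
    (fun f : Fin p → Bool => (Submodule.Quotient.mk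
      (PiTensorProduct.tprod R fun i => cond (f i) v w) : Coinv p R V))
    (fun k f => coinv_mk_tprod_rotate k fun i => cond (f i) v w)
  rw [cyclicDefect, powerDefect, mk_sum_smul_tprod, h, cyclicDefect, powerDefect,
    mk_sum_smul_tprod,
    ← Equiv.sum_comp (Equiv.arrowCongr (Equiv.refl (Fin p)) Equiv.boolNot)]
  refine Finset.sum_congr rfl fun f _ => ?_
  simp

/-- Each side is a weighted sum over words in the three letters `v`, `w`, `z`. The two weights come
from the two bracketings of the triple sum; both are orbit weights, so the classes agree. The
identity cannot be read off from traces, since the trace map kills the image of `ψ`. -/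
theorem cyclicDefect_assoc (v w z : V) :
    cyclicDefect p R v w + cyclicDefect p R (v + w) z =
      cyclicDefect p R v (w + z) + cyclicDefect p R w z := by
  let x : Fin 3 → V := ![v, w, z]
  have hW := isOrbitWeight_boolWeight (p := p)
  have h := hW.left_assoc.sum_eq (R := R) hW.right_assoc
    (fun f : Fin p → Fin 3 => (Submodule.Quotient.mk
      (PiTensorProduct.tprod R fun i => x (f i)) : Coinv p R V))
    (fun k f => coinv_mk_tprod_rotate k fun i => x (f i))
  have e1 := tprod_sum_sum (R := R) (boolWeight (p := p)) x (fun a => a = 0) (fun a => a = 1)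
    (by decide)
  have e2 := tprod_sum_sum (R := R) (boolWeight (p := p)) x (fun a => a = 0 ∨ a = 1)
    (fun a => a = 2) (by decide)
  have e3 := tprod_sum_sum (R := R) (boolWeight (p := p)) x (fun a => a = 0)
    (fun a => a = 1 ∨ a = 2) (by decide)
  have e4 := tprod_sum_sum (R := R) (boolWeight (p := p)) x (fun a => a = 1) (fun a => a = 2)
    (by decide)
  have c2 : ∀ f : Fin p → Fin 3, ∀ i, (f i = 0 ∨ f i = 1) ∨ f i = 2 := fun f i => by
    generalize f i = a
    revert a
    decide
  have c3 : ∀ f : Fin p → Fin 3, ∀ i, f i = 0 ∨ f i = 1 ∨ f i = 2 := fun f i => by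
    generalize f i = a
    revert a
    decide
  simp only [c2, implies_true, if_true] at e2
  simp only [c3, implies_true, if_true] at e3
  have s0 : (∑ a, if a = 0 then x a else 0) = v := by simp [x]
  have s1 : (∑ a, if a = 1 then x a else 0) = w := by simp [x]
  have s2 : (∑ a, if a = 2 then x a else 0) = z := by simp [x]
  have s01 : (∑ a, if a = 0 ∨ a = 1 then x a else 0) = v + w := by
    simp [Fin.sum_univ_three, x]
  have s12 : (∑ a, if a = 1 ∨ a = 2 then x a else 0) = w + z := by
    simp [Fin.sum_univ_three, x]
  rw [s0, s1] at e1
  rw [s01, s2] at e2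
  rw [s0, s12] at e3
  rw [s1, s2] at e4
  simp only [Int.cast_add, add_smul, Finset.sum_add_distrib, ← mk_sum_smul_tprod] at h
  simp only [cyclicDefect, powerDefect]
  rw [e1, e2, e3, e4]
  exact h

end Defect

/-! ### An explicit splitting over abelian groups. -/

section WittPair

set_option linter.unusedSectionVars false

/-- Pairs of a vector and a class in the cyclic power, with Witt vector addition. -/
@[ext]
structure WittPair (p : ℕ) (R : Type u) [CommRing R] (V : Type u) [AddCommGroup V]
    [Module R V] : Type u where
  vec : V
  cls : Coinv p R V

variable {p : ℕ} [Fact p.Prime] {R : Type u} [CommRing R]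
  {V W : Type u} [AddCommGroup V] [Module R V] [AddCommGroup W] [Module R W]

namespace WittPair

/-- The cocycle is subtracted so that `(v, x) ↦ v^{⊗p} + tr x` becomes additive: its trace is
exactly the failure of `v ↦ v^{⊗p}` to be additive. -/
noncomputable instance : Add (WittPair p R V) :=
  ⟨fun x y => ⟨x.vec + y.vec, x.cls + y.cls - cyclicDefect p R x.vec y.vec⟩⟩

noncomputable instance : Zero (WittPair p R V) := ⟨⟨0, 0⟩⟩

noncomputable instance : Neg (WittPair p R V) :=
  ⟨fun x => ⟨-x.vec, -x.cls + cyclicDefect p R (-x.vec) x.vec⟩⟩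

theorem vec_add (x y : WittPair p R V) : (x + y).vec = x.vec + y.vec := rfl

theorem cls_add (x y : WittPair p R V) :
    (x + y).cls = x.cls + y.cls - cyclicDefect p R x.vec y.vec := rfl

theorem vec_zero : (0 : WittPair p R V).vec = 0 := rfl

theorem cls_zero : (0 : WittPair p R V).cls = 0 := rfl

theorem vec_neg (x : WittPair p R V) : (-x).vec = -x.vec := rfl

theorem cls_neg (x : WittPair p R V) :
    (-x).cls = -x.cls + cyclicDefect p R (-x.vec) x.vec := rfl

theorem cyclicDefect_zero_right (v : V) : cyclicDefect p R v 0 = 0 := by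
  rw [cyclicDefect, powerDefect_zero_right, Submodule.Quotient.mk_zero]

theorem cyclicDefect_zero_left (v : V) : cyclicDefect p R 0 v = 0 := by
  rw [cyclicDefect_comm, cyclicDefect_zero_right]

noncomputable instance : AddCommGroup (WittPair p R V) where
  add_assoc x y z := by
    refine WittPair.ext (add_assoc _ _ _) ?_
    have h := cyclicDefect_assoc (p := p) (R := R) x.vec y.vec z.vec
    simp only [cls_add, vec_add]
    rw [← sub_eq_zero] at h ⊢
    rw [← neg_eq_zero, ← h]
    abel
  zero_add x := by
    refine WittPair.ext (zero_add _) ?_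
    simp only [cls_add, vec_zero, cls_zero, cyclicDefect_zero_left, zero_add, sub_zero]
  add_zero x := by
    refine WittPair.ext (add_zero _) ?_
    simp only [cls_add, vec_zero, cls_zero, cyclicDefect_zero_right, add_zero, sub_zero]
  add_comm x y := by
    refine WittPair.ext (add_comm _ _) ?_
    simp only [cls_add, cyclicDefect_comm x.vec, add_comm x.cls]
  neg_add_cancel x := by
    refine WittPair.ext (neg_add_cancel _) ?_
    simp only [cls_add, cls_neg, vec_neg, cls_zero]
    abel
  nsmul := nsmulRec
  zsmul := zsmulRec

/-- Functoriality of `WittPair`. -/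
noncomputable def map (p : ℕ) [Fact p.Prime] (g : V →ₗ[R] W) :
    WittPair p R V →+ WittPair p R W where
  toFun x := ⟨g x.vec, coinvMap p g x.cls⟩
  map_zero' := WittPair.ext (map_zero g) (map_zero _)
  map_add' x y := by
    refine WittPair.ext (map_add g _ _) ?_
    have h : coinvMap p g (cyclicDefect p R x.vec y.vec) =
        cyclicDefect p R (g x.vec) (g y.vec) :=
      congrArg Submodule.Quotient.mk (powMap_powerDefect g x.vec y.vec)
    simp only [cls_add, map_sub, map_add, h]

/-- The inclusion of the cyclic power. -/
noncomputable def ofCoinv (p : ℕ) [Fact p.Prime] (R : Type u) [CommRing R] (V : Type u)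
    [AddCommGroup V] [Module R V] : Coinv p R V →+ WittPair p R V where
  toFun x := ⟨0, x⟩
  map_zero' := rfl
  map_add' x y := WittPair.ext (add_zero 0).symm
    (by simp only [cls_add, cyclicDefect_zero_right, sub_zero])

theorem trace_cyclicDefect (v w : V) : trace p R V (cyclicDefect p R v w) =
    powInv p V R (v + w) - powInv p V R v - powInv p V R w :=
  Subtype.ext (traceEnd_powerDefect v w)

/-- The map `(v, x) ↦ v^{⊗ p} + tr x`. -/
noncomputable def ghost (p : ℕ) [Fact p.Prime] (R : Type u) [CommRing R] (V : Type u)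
    [AddCommGroup V] [Module R V] : WittPair p R V →+ Inv p R V :=
  AddMonoidHom.mk' (fun x => powInv p V R x.vec + trace p R V x.cls) fun x y => by
    simp only [cls_add, vec_add, map_sub, map_add, trace_cyclicDefect]
    abel

theorem ghost_apply (x : WittPair p R V) :
    ghost p R V x = powInv p V R x.vec + trace p R V x.cls := rfl

theorem psiHat_ghost (hR : (p : R) = 0) [Module.Finite R V] [Module.Projective R V]
    (x : WittPair p R V) :
    psiHat hR V (toTwist hR _ (ghost p R V x)) = frobMap hR V x.vec := by
  rw [ghost_apply, map_add, map_add, psiHat_trace, psiHat_powInv, add_zero]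

end WittPair

variable (hR : (p : R) = 0)

/-- The functor `V ↦ WittPair p R V`. -/
noncomputable def wittFunctor (p : ℕ) [Fact p.Prime] (R : Type u) [CommRing R] :
    RProj R ⥤ AddCommGrpCat.{u} where
  obj V := AddCommGrpCat.of (WittPair p R V.obj)
  map g := AddCommGrpCat.ofHom (WittPair.map p g.hom.hom)
  map_id V := by
    refine AddCommGrpCat.hom_ext (AddMonoidHom.ext fun x => WittPair.ext rfl ?_)
    obtain ⟨y, hy⟩ := Submodule.Quotient.mk_surjective _ (x : WittPair p R V.obj).cls
    change coinvMap p (LinearMap.id : V.obj →ₗ[R] V.obj) (x : WittPair p R V.obj).cls = (x : WittPair p R V.obj).cls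
    rw [← hy]
    exact congrArg Submodule.Quotient.mk (powMap_id p y)
  map_comp f g := by
    refine AddCommGrpCat.hom_ext (AddMonoidHom.ext fun x => WittPair.ext rfl ?_)
    obtain ⟨y, hy⟩ := Submodule.Quotient.mk_surjective _ (x : WittPair p R _).cls
    change coinvMap p (g.hom.hom ∘ₗ f.hom.hom) (x : WittPair p R _).cls =
      coinvMap p g.hom.hom (coinvMap p f.hom.hom (x : WittPair p R _).cls)
    rw [← hy]
    exact congrArg Submodule.Quotient.mk (powMap_comp p g.hom.hom f.hom.hom y)

/-- The map `WittPair p R V → (V^{⊗ p})^σ ×_{V^{(1)}} V`. -/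
noncomputable def wittGhost (V : RProj R) : WittPair p R V.obj →+ fibre hR V where
  toFun x := fibreMk hR V (WittPair.ghost p R V.obj x) x.vec (WittPair.psiHat_ghost hR x)
  map_zero' := Subtype.ext (Prod.ext (map_zero (WittPair.ghost p R V.obj)) rfl)
  map_add' x y := Subtype.ext (Prod.ext (map_add (WittPair.ghost p R V.obj) x y) rfl)

/-- The splitting of the cyclic-power extension over abelian groups given by `WittPair`. -/
noncomputable def wittSplitting : Splitting (cyclicExtension hR) where
  C₀₁ := wittFunctor p R
  pointed V hV := by
    have := RProj.subsingleton_of_isZero hV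
    have := subsingleton_coinv p R V.obj
    have h : Subsingleton (WittPair p R V.obj) :=
      ⟨fun x y => WittPair.ext (Subsingleton.elim _ _) (Subsingleton.elim _ _)⟩
    exact AddCommGrpCat.isZero_of_subsingleton (AddCommGrpCat.of (WittPair p R V.obj))
  c₁ :=
    { app := fun V => AddCommGrpCat.ofHom (WittPair.ofCoinv p R V.obj)
      naturality := fun V W g => by
        refine AddCommGrpCat.hom_ext (AddMonoidHom.ext fun x => WittPair.ext ?_ rfl)
        exact (map_zero g.hom.hom).symm }
  c₀ :=
    { app := fun V => AddCommGrpCat.ofHom (wittGhost hR V)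
      naturality := fun V W g => by
        refine AddCommGrpCat.hom_ext (AddMonoidHom.ext fun x =>
          Subtype.ext (Prod.ext ?_ rfl))
        change powInv p W.obj R (g.hom.hom (x : WittPair p R V.obj).vec) +
            trace p R W.obj (coinvMap p g.hom.hom (x : WittPair p R V.obj).cls) =
          invMap p g.hom.hom (powInv p V.obj R (x : WittPair p R V.obj).vec +
            trace p R V.obj (x : WittPair p R V.obj).cls)
        rw [map_add, invMap_powInv, invMap_trace] }
  comm := by
    ext V x
    refine Subtype.ext (Prod.ext ?_ rfl)
    change powInv p V.obj R 0 + trace p R V.obj x = trace p R V.obj x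
    rw [add_eq_right]
    exact Subtype.ext ((PiTensorProduct.tprod R).map_coord_zero (0 : Fin p) rfl)
  injective_c₁ V x y h := congrArg WittPair.cls h
  cartesian V x h := by
    obtain ⟨y, hy⟩ := h
    have h0 : (x : WittPair p R V.obj).vec = 0 := congrArg (fun z : fibre hR V => z.1.2) hy
    exact ⟨(x : WittPair p R V.obj).cls, WittPair.ext h0.symm rfl⟩
  surjective_c₀ V x := by
    have h1 := (mem_fibre hR).1 (x : fibre hR V).2
    -- For `(t, v)` in the fibre product, `t` and `v^{⊗p}` have the same image `Fr v` under `ψ̂`, so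
    -- they differ by a trace.
    obtain ⟨y, hy⟩ := exists_trace_eq_of_psiHat_eq_zero (V := V.obj) hR
      ((toTwist hR _).symm (x : fibre hR V).1.1 - powInv p V.obj R (x : fibre hR V).1.2) (by
        rw [map_sub, map_sub, psiHat_powInv, sub_eq_zero]
        exact h1)
    refine ⟨(⟨(x : fibre hR V).1.2, y⟩ : WittPair p R V.obj), Subtype.ext (Prod.ext ?_ rfl)⟩
    change powInv p V.obj R _ + trace p R V.obj y = (toTwist hR _).symm (x : fibre hR V).1.1
    rw [hy, add_sub_cancel]

end WittPair

/-! ### Cross effects of the tensor power on linear maps. -/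

section Cross

set_option linter.unusedSectionVars false

variable {p : ℕ} [Fact p.Prime] {R : Type u} [CommRing R]
  {V W X : Type u} [AddCommGroup V] [Module R V] [AddCommGroup W] [Module R W]
  [AddCommGroup X] [Module R X]

/-- For invariant `x`, a tensor whose trace is the cross effect of `g ↦ g^{⊗ p} x` at `a`, `b`. -/
noncomputable def crossPow (p : ℕ) [Fact p.Prime] (a b : V →ₗ[R] W) :
    (⨂[R]^p V) →ₗ[R] (⨂[R]^p W) :=
  ∑ f : Fin p → Bool, (boolWeight f : R) • PiTensorProduct.map fun i => cond (f i) a b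

theorem crossPow_apply (a b : V →ₗ[R] W) (x : ⨂[R]^p V) :
    crossPow p a b x =
      ∑ f : Fin p → Bool, (boolWeight f : R) • PiTensorProduct.map (fun i => cond (f i) a b) x := by
  simp [crossPow]

theorem powMap_add_eq_sum (a b : V →ₗ[R] W) :
    powMap p (a + b) = ∑ f : Fin p → Bool, PiTensorProduct.map fun i => cond (f i) a b := by
  refine PiTensorProduct.ext (MultilinearMap.ext fun v => ?_)
  have h := (PiTensorProduct.tprod R).map_sum fun (i : Fin p) (c : Bool) => cond c a b (v i)
  simp only [Fintype.sum_bool, cond_true, cond_false] at h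
  simp only [LinearMap.compMultilinearMap_apply, LinearMap.sum_apply, PiTensorProduct.map_tprod]
  rw [← h]
  exact PiTensorProduct.map_tprod _ _

theorem sigma_pow_map (k : Fin p) (g : Fin p → V →ₗ[R] W) (x : ⨂[R]^p V) :
    (sigma p R W ^ (k : ℕ)) (PiTensorProduct.map g x) =
      PiTensorProduct.map (fun i => g (i - k)) ((sigma p R V ^ (k : ℕ)) x) := by
  have h : (sigma p R W ^ (k : ℕ)) ∘ₗ PiTensorProduct.map g =
      PiTensorProduct.map (fun i => g (i - k)) ∘ₗ (sigma p R V ^ (k : ℕ)) := by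
    refine PiTensorProduct.ext (MultilinearMap.ext fun v => ?_)
    simp only [LinearMap.compMultilinearMap_apply, LinearMap.comp_apply, PiTensorProduct.map_tprod,
      sigma_pow_tprod]
  exact LinearMap.congr_fun h x

/-- As `σ` fixes `x`, applying `σ^k` only rotates the word of maps; the trace is then the sum over
nonconstant words in `a` and `b`. -/
theorem traceEnd_crossPow (a b : V →ₗ[R] W) (x : Inv p R V) :
    traceEnd p R W (crossPow p a b x) =
      powMap p (a + b) (x : ⨂[R]^p V) - powMap p a (x : ⨂[R]^p V) -
        powMap p b (x : ⨂[R]^p V) := by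
  have h := isOrbitWeight_boolWeight.sum_sum_rotate (R := R)
    fun f : Fin p → Bool => PiTensorProduct.map (fun i => cond (f i) a b) (x : ⨂[R]^p V)
  rw [powMap_add_eq_sum, LinearMap.sum_apply, sub_sub, traceEnd_apply]
  simp only [crossPow_apply, map_sum, map_smul, sigma_pow_map, sigma_pow_inv]
  rw [h]
  simp [powMap]

theorem powMap_crossPow (g : W →ₗ[R] X) (a b : V →ₗ[R] W) (x : ⨂[R]^p V) :
    powMap p g (crossPow p a b x) = crossPow p (g ∘ₗ a) (g ∘ₗ b) x := by
  simp only [crossPow_apply, map_sum, map_smul]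
  refine Finset.sum_congr rfl fun f _ => ?_
  congr 1
  have h := LinearMap.congr_fun
    (PiTensorProduct.map_comp (fun _ => g) fun i => cond (f i) a b) x
  refine Eq.trans h.symm ?_
  congr 2
  funext i
  cases f i <;> rfl

/-- By multilinearity each word of scalar maps acts as the product of its scalars, with the same
weights as in `powDefect`. This is where the Witt vector polynomial enters the functorial side. -/
theorem crossPow_smul_id (r s : R) (x : ⨂[R]^p V) :
    crossPow p (r • (LinearMap.id : V →ₗ[R] V)) (s • (LinearMap.id : V →ₗ[R] V)) x =
      powDefect p r s • x := by
  have h : crossPow p (r • (LinearMap.id : V →ₗ[R] V)) (s • (LinearMap.id : V →ₗ[R] V)) =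
      powDefect p r s • LinearMap.id := by
    refine PiTensorProduct.ext (MultilinearMap.ext fun v => ?_)
    change crossPow p _ _ (PiTensorProduct.tprod R v) =
      powDefect p r s • PiTensorProduct.tprod R v
    simp only [crossPow_apply, PiTensorProduct.map_tprod, powDefect, Finset.sum_smul, mul_smul]
    refine Finset.sum_congr rfl fun f _ => ?_
    have e := (PiTensorProduct.tprod R).map_smul_univ (fun i => cond (f i) r s) v
    rw [← e]
    congr 2
    funext i
    cases f i <;> rfl
  exact LinearMap.congr_fun h x

theorem map_eq_zero_of_apply_eq_zero (g : Fin p → V →ₗ[R] W) (i : Fin p) (hi : g i = 0) :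
    PiTensorProduct.map g = 0 := by
  refine PiTensorProduct.ext (MultilinearMap.ext fun v => ?_)
  simp only [LinearMap.compMultilinearMap_apply, PiTensorProduct.map_tprod]
  exact (PiTensorProduct.tprod R).map_coord_zero i (by rw [hi]; rfl)

theorem crossPow_zero_right (a : V →ₗ[R] W) : crossPow p a 0 = 0 := by
  refine Finset.sum_eq_zero fun f _ => ?_
  by_cases hf : f = fun _ => true
  · rw [hf, isOrbitWeight_boolWeight.const, Int.cast_zero, zero_smul]
  · obtain ⟨i, hi⟩ : ∃ i, f i = false := by
      by_contra h
      push Not at h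
      exact hf (funext fun i => by simpa using h i)
    rw [map_eq_zero_of_apply_eq_zero _ i (by rw [hi, cond_false]), smul_zero]

theorem crossPow_zero_left (b : V →ₗ[R] W) : crossPow p 0 b = 0 := by
  refine Finset.sum_eq_zero fun f _ => ?_
  by_cases hf : f = fun _ => false
  · rw [hf, isOrbitWeight_boolWeight.const, Int.cast_zero, zero_smul]
  · obtain ⟨i, hi⟩ : ∃ i, f i = true := by
      by_contra h
      push Not at h
      exact hf (funext fun i => by simpa using h i)
    rw [map_eq_zero_of_apply_eq_zero _ i (by rw [hi, cond_true]), smul_zero]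

theorem powMap_smul_id (r : R) (x : ⨂[R]^p V) :
    powMap p (r • (LinearMap.id : V →ₗ[R] V)) x = r ^ p • x := by
  have h : powMap p (r • (LinearMap.id : V →ₗ[R] V)) = r ^ p • LinearMap.id := by
    refine PiTensorProduct.ext (MultilinearMap.ext fun v => ?_)
    have h := (PiTensorProduct.tprod R).map_smul_univ (fun _ : Fin p => r) v
    rw [Finset.prod_const, Finset.card_univ, Fintype.card_fin] at h
    refine Eq.trans ?_ h
    exact PiTensorProduct.map_tprod _ _
  exact LinearMap.congr_fun h x

end Cross

/-! ### The additive defect of an arbitrary splitting on linear maps. -/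

section General

variable {p : ℕ} [Fact p.Prime] {R : Type u} [CommRing R] {hR : (p : R) = 0}

/-- A linear map as a morphism of `R-proj`. -/
def RProj.homMk {V W : RProj R} (g : V.obj →ₗ[R] W.obj) : V ⟶ W := ⟨ModuleCat.ofHom g⟩

/-- The free module of rank one as an object of `R-proj`. -/
def RProj.unit (R : Type u) [CommRing R] : RProj R :=
  ⟨ModuleCat.of R R, inferInstanceAs (Module.Finite R R), inferInstanceAs (Module.Projective R R)⟩

/-- The direct sum of two copies of `V`. -/
def RProj.double (V : RProj R) : RProj R :=
  ⟨ModuleCat.of R (V.obj × V.obj), inferInstanceAs (Module.Finite R (V.obj × V.obj)),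
    inferInstanceAs (Module.Projective R (V.obj × V.obj))⟩

namespace Splitting

variable (S : Splitting (cyclicExtension hR))

/-- The map `c₁` on objects. -/
noncomputable def inc (V : RProj R) : Twist hR (Coinv p R V.obj) →+ S.C₀₁.obj V := (S.c₁.app V).hom

/-- The map `c₀` on objects. -/
noncomputable def proj (V : RProj R) : S.C₀₁.obj V →+ fibre hR V := (S.c₀.app V).hom

/-- The functor `C₀₁` on linear maps. -/
noncomputable def mapLin {V W : RProj R} (g : V.obj →ₗ[R] W.obj) : S.C₀₁.obj V →+ S.C₀₁.obj W :=
  (S.C₀₁.map (RProj.homMk g)).hom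

/-- The composite `C₀₁ → C₀ → I` on objects. -/
noncomputable def vec {V : RProj R} (y : S.C₀₁.obj V) : V.obj := (S.proj V y).1.2

/-- The invariant tensor underlying an element of `C₀₁`. -/
noncomputable def tensor {V : RProj R} (y : S.C₀₁.obj V) : Inv p R V.obj :=
  (toTwist hR _).symm (S.proj V y).1.1

theorem inc_injective (V : RProj R) : Function.Injective (S.inc V) := S.injective_c₁ V

theorem mapLin_inc {V W : RProj R} (g : V.obj →ₗ[R] W.obj) (x : Twist hR (Coinv p R V.obj)) :
    S.mapLin g (S.inc V x) = S.inc W (twistMap hR (coinvMap p g) x) :=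
  (congrArg (fun f => f.hom x) (S.c₁.naturality (RProj.homMk g))).symm

theorem proj_mapLin {V W : RProj R} (g : V.obj →ₗ[R] W.obj) (y : S.C₀₁.obj V) :
    S.proj W (S.mapLin g y) = fibreMap hR g (S.proj V y) :=
  congrArg (fun f => f.hom y) (S.c₀.naturality (RProj.homMk g))

theorem vec_mapLin {V W : RProj R} (g : V.obj →ₗ[R] W.obj) (y : S.C₀₁.obj V) :
    S.vec (S.mapLin g y) = g (S.vec y) :=
  congrArg (fun z : fibre hR W => z.1.2) (S.proj_mapLin g y)

theorem tensor_mapLin {V W : RProj R} (g : V.obj →ₗ[R] W.obj) (y : S.C₀₁.obj V) :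
    S.tensor (S.mapLin g y) = invMap p g (S.tensor y) :=
  congrArg (fun z : fibre hR W => z.1.1) (S.proj_mapLin g y)

theorem mapLin_comp {V W X : RProj R} (h : W.obj →ₗ[R] X.obj) (g : V.obj →ₗ[R] W.obj)
    (y : S.C₀₁.obj V) : S.mapLin (h ∘ₗ g) y = S.mapLin h (S.mapLin g y) :=
  congrArg (fun f => f.hom y) (S.C₀₁.map_comp (RProj.homMk g) (RProj.homMk h))

theorem mapLin_id {V : RProj R} (y : S.C₀₁.obj V) : S.mapLin (V := V) LinearMap.id y = y :=
  congrArg (fun f => f.hom y) (S.C₀₁.map_id V)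

theorem proj_inc {V : RProj R} (x : Twist hR (Coinv p R V.obj)) :
    S.proj V (S.inc V x) = (((cyclicExtension hR).d.app V).hom x : fibre hR V) :=
  congrArg (fun f => (f.app V).hom x) S.comm

theorem vec_inc {V : RProj R} (x : Twist hR (Coinv p R V.obj)) : S.vec (S.inc V x) = 0 :=
  congrArg (fun z : fibre hR V => z.1.2) (S.proj_inc x)

theorem tensor_inc {V : RProj R} (x : Coinv p R V.obj) :
    S.tensor (S.inc V (toTwist hR _ x)) = trace p R V.obj x :=
  congrArg (fun z : fibre hR V => z.1.1) (S.proj_inc (toTwist hR _ x))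

theorem vec_add {V : RProj R} (y z : S.C₀₁.obj V) : S.vec (y + z) = S.vec y + S.vec z :=
  congrArg (fun z : fibre hR V => z.1.2) (map_add (S.proj V) y z)

theorem vec_sub {V : RProj R} (y z : S.C₀₁.obj V) : S.vec (y - z) = S.vec y - S.vec z :=
  congrArg (fun z : fibre hR V => z.1.2) (map_sub (S.proj V) y z)

theorem tensor_sub {V : RProj R} (y z : S.C₀₁.obj V) :
    S.tensor (y - z) = S.tensor y - S.tensor z :=
  congrArg (fun z : fibre hR V => (toTwist hR _).symm z.1.1) (map_sub (S.proj V) y z)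

theorem psiHat_tensor {V : RProj R} (y : S.C₀₁.obj V) :
    psiHat hR V.obj (toTwist hR _ (S.tensor y)) = frobMap hR V.obj (S.vec y) :=
  (mem_fibre hR).1 (S.proj V y).2

theorem proj_eq_iff {V : RProj R} {y z : S.C₀₁.obj V} :
    S.proj V y = S.proj V z ↔ S.tensor y = S.tensor z ∧ S.vec y = S.vec z := by
  constructor
  · intro h
    exact ⟨congrArg (fun z : fibre hR V => (toTwist hR _).symm z.1.1) h,
      congrArg (fun z : fibre hR V => z.1.2) h⟩
  · rintro ⟨h1, h2⟩
    exact Subtype.ext (Prod.ext h1 h2)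

theorem exists_vec_eq {V : RProj R} (v : V.obj) : ∃ y : S.C₀₁.obj V, S.vec y = v := by
  obtain ⟨y, hy⟩ := S.surjective_c₀ V (fibreMk hR V (powInv p V.obj R v) v (psiHat_powInv hR v))
  exact ⟨y, congrArg (fun z : fibre hR V => z.1.2) hy⟩

/-- A vanishing vector puts the tensor of `y` in `ker ψ̂ = Im tr`, so `c₀ y` lies in `Im d` and the
cartesian square applies. -/
theorem exists_inc_eq {V : RProj R} (y : S.C₀₁.obj V) (hy : S.vec y = 0) :
    ∃ x, S.inc V x = y := by
  refine S.cartesian V y ?_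
  have h := S.psiHat_tensor y
  rw [hy, map_zero] at h
  obtain ⟨x, hx⟩ := exists_trace_eq_of_psiHat_eq_zero hR _ h
  exact ⟨toTwist hR _ x, Subtype.ext (Prod.ext hx.symm hy)⟩

/-- The kernel of `c₀` is the copy `c₁ ψ(V^{(1)})` of the additive functor `V^{(1)}`; every later
uniqueness argument takes place there. -/
theorem exists_inc_psi_eq {V : RProj R} (y : S.C₀₁.obj V) (hy : S.vec y = 0)
    (hy' : S.tensor y = 0) : ∃ u, S.inc V (psi hR V.obj u) = y := by
  obtain ⟨x, rfl⟩ := S.exists_inc_eq y hy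
  obtain ⟨x, rfl⟩ := (toTwist hR _).surjective x
  rw [tensor_inc] at hy'
  obtain ⟨u, hu⟩ := exists_psi_eq_of_trace_eq_zero hR x hy'
  exact ⟨u, by rw [hu]⟩

theorem mapLin_inc_psi {V W : RProj R} (g : V.obj →ₗ[R] W.obj) (u : VTwist hR V.obj) :
    S.mapLin g (S.inc V (psi hR V.obj u)) =
      S.inc W (psi hR W.obj (LinearMap.lTensor (Twist hR R) g u)) := by
  rw [mapLin_inc, psi_lTensor]

theorem mapLin_zero {V W : RProj R} (y : S.C₀₁.obj V) :
    S.mapLin (0 : V.obj →ₗ[R] W.obj) y = 0 := by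
  have h1 : ∀ {W : RProj R} (z : S.C₀₁.obj W), S.vec z = 0 → S.tensor z = 0 →
      S.mapLin (0 : W.obj →ₗ[R] W.obj) z = 0 := by
    intro W z hz hz'
    obtain ⟨u, rfl⟩ := S.exists_inc_psi_eq z hz hz'
    rw [mapLin_inc_psi, LinearMap.lTensor_zero, LinearMap.zero_apply, map_zero, map_zero]
  -- Write the zero map as a composite with another zero map. After the first one the element lies
  -- in `ker c₀`, where the functor is additive and so sends zero maps to zero.
  have h2 : S.mapLin (0 : V.obj →ₗ[R] W.obj) y =
      S.mapLin (0 : W.obj →ₗ[R] W.obj) (S.mapLin (0 : V.obj →ₗ[R] W.obj) y) := by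
    rw [← mapLin_comp, LinearMap.zero_comp]
  rw [h2]
  refine h1 _ (S.vec_mapLin _ _) ?_
  rw [tensor_mapLin]
  refine Subtype.ext ?_
  exact LinearMap.congr_fun
    (map_eq_zero_of_apply_eq_zero (fun _ => (0 : V.obj →ₗ[R] W.obj)) (0 : Fin p) rfl) _

/-- The additive defect of `g ↦ C₀₁(g)`. -/
theorem mapLin_add {V W : RProj R} (a b : V.obj →ₗ[R] W.obj) (y : S.C₀₁.obj V) :
    S.mapLin (a + b) y = S.mapLin a y + S.mapLin b y +
      S.inc W (toTwist hR _ (Submodule.Quotient.mk (crossPow p a b (S.tensor y)))) := by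
  -- The universal case: every pair `a`, `b` is obtained from the two inclusions by composing with
  -- the map `(a, b)` on `V ⊕ V`.
  have key : ∀ (i₁ i₂ : V.obj →ₗ[R] V.double.obj), i₁ = LinearMap.inl R V.obj V.obj →
      i₂ = LinearMap.inr R V.obj V.obj → S.mapLin (i₁ + i₂) y = S.mapLin i₁ y + S.mapLin i₂ y +
      S.inc V.double (toTwist hR _ (Submodule.Quotient.mk (crossPow p i₁ i₂ (S.tensor y)))) := by
    intro i₁ i₂ h₁ h₂
    let q₁ : V.double.obj →ₗ[R] V.obj := LinearMap.fst R V.obj V.obj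
    let q₂ : V.double.obj →ₗ[R] V.obj := LinearMap.snd R V.obj V.obj
    have h11 : q₁ ∘ₗ i₁ = LinearMap.id := by rw [h₁]; rfl
    have h12 : q₁ ∘ₗ i₂ = 0 := by rw [h₂]; rfl
    have h21 : q₂ ∘ₗ i₁ = 0 := by rw [h₁]; rfl
    have h22 : q₂ ∘ₗ i₂ = LinearMap.id := by rw [h₂]; rfl
    have hsum : i₁ ∘ₗ q₁ + i₂ ∘ₗ q₂ = LinearMap.id := by
      rw [h₁, h₂]
      exact LinearMap.ext fun x => Prod.ext (add_zero _) (zero_add _)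
    set t : Coinv p R V.double.obj :=
      Submodule.Quotient.mk (crossPow p i₁ i₂ (S.tensor y)) with ht
    set z := S.mapLin (i₁ + i₂) y - S.mapLin i₁ y - S.mapLin i₂ y - S.inc _ (toTwist hR _ t)
      with hz
    have hzt : S.tensor z = 0 := by
      simp only [hz, tensor_sub, tensor_mapLin, tensor_inc]
      refine Subtype.ext ?_
      have := traceEnd_crossPow i₁ i₂ (S.tensor y)
      exact sub_eq_zero.2 this.symm
    have hzv : S.vec z = 0 := by
      simp only [hz, vec_sub, vec_mapLin, vec_inc, LinearMap.add_apply]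
      abel
    -- The discrepancy `z` between the two sides has zero tensor and zero vector, so it is given by
    -- some `u` in `(V ⊕ V)^{(1)}`. The projections show that `u = 0`: under each, one of the two
    -- inclusions becomes zero, and then both the cross term and the discrepancy vanish.
    obtain ⟨u, hu⟩ := S.exists_inc_psi_eq z hzv hzt
    have hmap : ∀ g : V.double.obj →ₗ[R] V.obj, twistMap hR (coinvMap p g) (toTwist hR _ t) =
        toTwist hR _ (Submodule.Quotient.mk (crossPow p (g ∘ₗ i₁) (g ∘ₗ i₂) (S.tensor y))) :=
      fun g => congrArg (fun x => toTwist hR (Coinv p R V.obj) (Submodule.Quotient.mk x))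
        (powMap_crossPow g i₁ i₂ (S.tensor y : ⨂[R]^p V.obj))
    have hu0 : ∀ g : V.double.obj →ₗ[R] V.obj, S.mapLin g z = 0 →
        LinearMap.lTensor (Twist hR R) g u = 0 := by
      intro g hg
      rw [← hu, mapLin_inc_psi] at hg
      exact psi_injective hR ((S.inc_injective _ (hg.trans (map_zero _).symm)).trans
        (map_zero _).symm)
    have hz1 : S.mapLin q₁ z = 0 := by
      rw [hz, map_sub, map_sub, map_sub, ← mapLin_comp, ← mapLin_comp, ← mapLin_comp, mapLin_inc,
        hmap, LinearMap.comp_add, h11, h12, add_zero, mapLin_zero, crossPow_zero_right]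
      simp
    have hz2 : S.mapLin q₂ z = 0 := by
      rw [hz, map_sub, map_sub, map_sub, ← mapLin_comp, ← mapLin_comp, ← mapLin_comp, mapLin_inc,
        hmap, LinearMap.comp_add, h21, h22, zero_add, mapLin_zero, crossPow_zero_left]
      simp
    have hu' : u = 0 := by
      have h := congrArg (fun g => LinearMap.lTensor (Twist hR R) g u) hsum
      simp only [LinearMap.lTensor_add, LinearMap.lTensor_comp, LinearMap.add_apply,
        LinearMap.comp_apply, hu0 q₁ hz1, hu0 q₂ hz2, map_zero, add_zero, LinearMap.lTensor_id,
        LinearMap.id_apply] at h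
      exact h.symm
    rw [hu', map_zero, map_zero] at hu
    rw [sub_sub, sub_sub, ← hu] at hz
    rw [sub_eq_zero.1 hz.symm]
    abel
  obtain ⟨i₁, h₁⟩ : ∃ i : V.obj →ₗ[R] V.double.obj, i = LinearMap.inl R V.obj V.obj := ⟨_, rfl⟩
  obtain ⟨i₂, h₂⟩ : ∃ i : V.obj →ₗ[R] V.double.obj, i = LinearMap.inr R V.obj V.obj := ⟨_, rfl⟩
  let g : V.double.obj →ₗ[R] W.obj := LinearMap.coprod a b
  have hg1 : g ∘ₗ i₁ = a := by rw [h₁]; exact LinearMap.coprod_inl a b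
  have hg2 : g ∘ₗ i₂ = b := by rw [h₂]; exact LinearMap.coprod_inr a b
  have h := congrArg (S.mapLin g) (key i₁ i₂ h₁ h₂)
  rw [map_add, map_add, ← mapLin_comp, ← mapLin_comp, ← mapLin_comp, mapLin_inc,
    LinearMap.comp_add, hg1, hg2] at h
  rw [h]
  congr 2
  have := powMap_crossPow g i₁ i₂ (S.tensor y : ⨂[R]^p V.obj)
  rw [hg1, hg2] at this
  exact congrArg (fun x => toTwist hR (Coinv p R W.obj) (Submodule.Quotient.mk x)) this

/-- The cross term is `powDefect p r s` times the class of the tensor of `y`. By `psi_psiHat` and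
the fibre product condition that class is `ψ (1 ⊗ vec y)`, so the defect is the endomorphism
attached to `powDefect p r s`. -/
theorem mapLin_add_smul_id {V : RProj R} (r s : R) (y : S.C₀₁.obj V) :
    S.mapLin (V := V) ((r + s) • LinearMap.id) y =
      S.mapLin (V := V) (r • LinearMap.id) y + S.mapLin (V := V) (s • LinearMap.id) y +
        S.inc V (psi hR V.obj (toTwist hR R (powDefect p r s) ⊗ₜ[R] S.vec y)) := by
  have h1 : psi hR V.obj (toTwist hR R 1 ⊗ₜ[R] S.vec y) =
      toTwist hR _ (Submodule.Quotient.mk (S.tensor y : ⨂[R]^p V.obj)) := by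
    rw [← frobMap_apply, ← psiHat_tensor, psi_psiHat]
  rw [psi_tmul, one_smul] at h1
  rw [add_smul, mapLin_add, crossPow_smul_id, psi_tmul, (toTwist hR _).injective h1]
  rfl

end Splitting

end General

/-! ### The ring of regular endomorphisms as a square-zero extension. -/

section RegularEnd

variable {p : ℕ} [Fact p.Prime] {R : Type u} [CommRing R] {hR : (p : R) = 0}

namespace Splitting

variable (S : Splitting (cyclicExtension hR))

/-- An endomorphism of `C₀₁` on objects. -/
def endApp (f : End S.C₀₁) (V : RProj R) : S.C₀₁.obj V →+ S.C₀₁.obj V :=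
  ((show S.C₀₁ ⟶ S.C₀₁ from f).app V).hom

theorem endApp_ext {f g : End S.C₀₁} (h : ∀ V y, S.endApp f V y = S.endApp g V y) : f = g :=
  NatTrans.ext (funext fun V => AddCommGrpCat.hom_ext (AddMonoidHom.ext (h V)))

theorem endApp_mul (f g : End S.C₀₁) (V : RProj R) (y : S.C₀₁.obj V) :
    S.endApp (f * g) V y = S.endApp f V (S.endApp g V y) := rfl

theorem endApp_mapLin (f : End S.C₀₁) {V W : RProj R} (g : V.obj →ₗ[R] W.obj)
    (y : S.C₀₁.obj V) : S.endApp f W (S.mapLin g y) = S.mapLin g (S.endApp f V y) :=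
  congrArg (fun h => h.hom y) ((show S.C₀₁ ⟶ S.C₀₁ from f).naturality (RProj.homMk g))

theorem isRegularWith_iff {r : R} {f : End S.C₀₁} : S.IsRegularWith r f ↔
    (∀ V x, S.endApp f V (S.inc V x) = S.inc V (r • x)) ∧
      ∀ V y, S.proj V (S.endApp f V y) = r • S.proj V y := by
  constructor
  · rintro ⟨h1, h2⟩
    exact ⟨fun V x => congrArg (fun t => (t.app V).hom x) h1,
      fun V y => congrArg (fun t => (t.app V).hom y) h2⟩
  · rintro ⟨h1, h2⟩
    exact ⟨NatTrans.ext (funext fun V => AddCommGrpCat.hom_ext (AddMonoidHom.ext (h1 V))),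
      NatTrans.ext (funext fun V => AddCommGrpCat.hom_ext (AddMonoidHom.ext (h2 V)))⟩

theorem endApp_inclEnd (m : Twist hR R) (V : RProj R) (y : S.C₀₁.obj V) :
    S.endApp (S.inclEnd m) V y = S.inc V (psi hR V.obj (m ⊗ₜ[R] S.vec y)) := rfl

theorem IsRegularWith.vec_endApp {S : Splitting (cyclicExtension hR)} {r : R} {f : End S.C₀₁}
    (h : S.IsRegularWith r f) {V : RProj R} (y : S.C₀₁.obj V) :
    S.vec (S.endApp f V y) = r • S.vec y :=
  congrArg (fun z : fibre hR V => z.1.2) ((S.isRegularWith_iff.1 h).2 V y)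

/-- An element of `C₀₁(R)` over `1`. -/
noncomputable def gen : S.C₀₁.obj (RProj.unit R) :=
  Classical.choose (S.exists_vec_eq (V := RProj.unit R) (1 : R))

theorem vec_gen : S.vec S.gen = (1 : R) :=
  Classical.choose_spec (S.exists_vec_eq (V := RProj.unit R) (1 : R))

/-- The scalar by which an endomorphism of `C₀₁` acts on `I`. -/
noncomputable def scalar (f : End S.C₀₁) : R := S.vec (S.endApp f (RProj.unit R) S.gen)

/-- Evaluating at an element over `1 : R` recovers `r`, so the scalar of a regular endomorphism is
unique. -/
theorem IsRegularWith.scalar_eq {S : Splitting (cyclicExtension hR)} {r : R} {f : End S.C₀₁}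
    (h : S.IsRegularWith r f) : S.scalar f = r := by
  refine (h.vec_endApp S.gen).trans ?_
  rw [vec_gen]
  exact mul_one r

theorem isRegularWith_scalar (f : S.regularEnd) : S.IsRegularWith (S.scalar f) f := by
  obtain ⟨f, r, hr⟩ := f
  change S.IsRegularWith (S.scalar f) f
  rwa [hr.scalar_eq]

/-- The map `R' → R`. -/
noncomputable def regularProj : S.regularEnd →+* R where
  toFun f := S.scalar f
  map_one' := S.vec_gen
  map_mul' f g := by
    change S.vec (S.endApp (f.1 * g.1) _ _) = _
    rw [endApp_mul, (S.isRegularWith_scalar f).vec_endApp]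
    rfl
  map_zero' := congrArg (fun z : fibre hR (RProj.unit R) => z.1.2) (map_zero (S.proj _))
  map_add' f g := S.vec_add _ _

theorem regularProj_apply (f : S.regularEnd) : S.regularProj f = S.scalar f := rfl

/-- Multiplication by `r` on `V` induces a regular endomorphism of `C₀₁`. -/
noncomputable def scaleEnd (r : R) : End S.C₀₁ :=
  show S.C₀₁ ⟶ S.C₀₁ from
  { app := fun V => S.C₀₁.map (RProj.homMk (V := V) (W := V) (r • LinearMap.id))
    naturality := fun V W g => by
      rw [← S.C₀₁.map_comp, ← S.C₀₁.map_comp]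
      congr 1
      exact InducedCategory.hom_ext (ModuleCat.hom_ext
        (LinearMap.ext fun v => (g.hom.hom.map_smul r v).symm)) }

theorem endApp_scaleEnd (r : R) (V : RProj R) (y : S.C₀₁.obj V) :
    S.endApp (S.scaleEnd r) V y = S.mapLin (V := V) (r • LinearMap.id) y := rfl

/-- The map `r · id` acts on `V^{⊗p}` as `r^p`, which is the Frobenius-twisted action of `r` on `C₁`
and on the first factor of `C₀`. -/
theorem isRegularWith_scaleEnd (r : R) : S.IsRegularWith r (S.scaleEnd r) := by
  refine S.isRegularWith_iff.2 ⟨fun V x => ?_, fun V y => ?_⟩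
  · rw [endApp_scaleEnd, mapLin_inc]
    congr 1
    obtain ⟨x, rfl⟩ := (toTwist hR _).surjective x
    obtain ⟨x, rfl⟩ := Submodule.Quotient.mk_surjective _ x
    exact congrArg (fun t => toTwist hR (Coinv p R V.obj) (Submodule.Quotient.mk t))
      (powMap_smul_id r x)
  · rw [endApp_scaleEnd, proj_mapLin]
    exact Subtype.ext (Prod.ext (Subtype.ext (powMap_smul_id r _)) rfl)

/-- The multiplicative section `r ↦ C₀₁(r)` of `R' → R`. -/
noncomputable def regularSection : R →* S.regularEnd where
  toFun r := ⟨S.scaleEnd r, r, S.isRegularWith_scaleEnd r⟩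
  map_one' := Subtype.ext (S.endApp_ext fun V y => by
    rw [endApp_scaleEnd, one_smul, mapLin_id]
    rfl)
  map_mul' r s := Subtype.ext (S.endApp_ext fun V y => by
    change S.endApp (S.scaleEnd (r * s)) V y = S.endApp (S.scaleEnd r * S.scaleEnd s) V y
    have h : (r * s) • (LinearMap.id : V.obj →ₗ[R] V.obj) =
        (r • LinearMap.id) ∘ₗ (s • LinearMap.id) := LinearMap.ext fun v => mul_smul r s v
    rw [endApp_mul, endApp_scaleEnd, endApp_scaleEnd, endApp_scaleEnd, ← mapLin_comp, h])

theorem regularProj_regularSection (r : R) : S.regularProj (S.regularSection r) = r :=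
  (S.isRegularWith_scaleEnd r).scalar_eq

theorem regularSection_add (r s : R) : S.regularSection (r + s) =
    S.regularSection r + S.regularSection s + S.incl (toTwist hR R (powDefect p r s)) :=
  Subtype.ext (S.endApp_ext fun _ y => S.mapLin_add_smul_id r s y)

theorem regularProj_incl (m : Twist hR R) : S.regularProj (S.incl m) = 0 :=
  (S.inclEnd_isRegularWith m).scalar_eq

theorem incl_mul (m : Twist hR R) (f : S.regularEnd) :
    S.incl m * f = S.incl (S.regularProj f • m) :=
  Subtype.ext (S.endApp_ext fun V y => by
    change S.endApp (S.inclEnd m * f.1) V y = S.endApp (S.inclEnd (S.scalar f • m)) V y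
    rw [endApp_mul, endApp_inclEnd, endApp_inclEnd, (S.isRegularWith_scalar f).vec_endApp,
      TensorProduct.smul_tmul])

theorem mul_incl (m : Twist hR R) (f : S.regularEnd) :
    f * S.incl m = S.incl (S.regularProj f • m) :=
  Subtype.ext (S.endApp_ext fun V y => by
    change S.endApp (f.1 * S.inclEnd m) V y = S.endApp (S.inclEnd (S.scalar f • m)) V y
    rw [endApp_mul, endApp_inclEnd, endApp_inclEnd,
      (S.isRegularWith_iff.1 (S.isRegularWith_scalar f)).1, ← map_smul,
      TensorProduct.smul_tmul'])

theorem incl_injective : Function.Injective S.incl := by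
  rw [injective_iff_map_eq_zero]
  intro m hm
  have h : S.endApp (S.inclEnd m) (RProj.unit R) S.gen = 0 :=
    congrArg (fun f : S.regularEnd => S.endApp f.1 (RProj.unit R) S.gen) hm
  rw [endApp_inclEnd, vec_gen] at h
  have h2 : m ⊗ₜ[R] (1 : R) = 0 :=
    psi_injective (V := (RProj.unit R).obj) hR ((S.inc_injective _ (h.trans (map_zero _).symm)).trans
      (map_zero _).symm)
  simpa using congrArg (TensorProduct.rid R (Twist hR R)) h2

/-- An `f` with scalar 0 kills `Im c₁` and takes values in `ker c₀`, so it amounts to a natural map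
from `V` to `V^{(1)}`. Such a map is determined by its value `m ⊗ 1` at `1 : R`. -/
theorem exists_incl_eq (f : S.regularEnd) (hf : S.regularProj f = 0) : ∃ m, S.incl m = f := by
  have hreg := S.isRegularWith_scalar f
  rw [← regularProj_apply, hf] at hreg
  obtain ⟨h1, h2⟩ := S.isRegularWith_iff.1 hreg
  have h3 : ∀ V (x : Twist hR (Coinv p R V.obj)), S.endApp f V (S.inc V x) = 0 := by
    intro V x
    rw [h1, zero_smul, map_zero]
  have h4 := h2 (RProj.unit R) S.gen
  rw [zero_smul, ← map_zero (S.proj _), proj_eq_iff] at h4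
  have htensor : S.tensor (0 : S.C₀₁.obj (RProj.unit R)) = 0 :=
    congrArg (fun z : fibre hR (RProj.unit R) => (toTwist hR _).symm z.1.1) (map_zero (S.proj _))
  have hvec : S.vec (0 : S.C₀₁.obj (RProj.unit R)) = 0 :=
    congrArg (fun z : fibre hR (RProj.unit R) => z.1.2) (map_zero (S.proj _))
  obtain ⟨u, hu⟩ := S.exists_inc_psi_eq _ (h4.2.trans hvec) (h4.1.trans htensor)
  obtain ⟨m, hm⟩ : ∃ m : Twist hR R, m ⊗ₜ[R] (1 : R) = u :=
    ⟨TensorProduct.rid R (Twist hR R) u, (TensorProduct.rid R (Twist hR R)).symm_apply_apply u⟩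
  refine ⟨m, Subtype.ext (S.endApp_ext fun V y => ?_)⟩
  -- Naturality along `1 ↦ vec y` transports the value at `S.gen` to `V`; `y` differs from the image
  -- of `S.gen` by an element of `Im c₁`, which `f` kills.
  let g : (RProj.unit R).obj →ₗ[R] V.obj := LinearMap.toSpanSingleton R V.obj (S.vec y)
  have hg : g (1 : R) = S.vec y := one_smul R _
  obtain ⟨x, hx⟩ := S.exists_inc_eq (y - S.mapLin g S.gen) (by
    rw [vec_sub, vec_mapLin, vec_gen, hg, sub_self])
  have hy : y = S.mapLin g S.gen + S.inc V x := by rw [hx, add_sub_cancel]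
  change S.endApp (S.inclEnd m) V y = S.endApp f V y
  rw [endApp_inclEnd]
  conv_rhs => rw [hy, map_add, h3, add_zero, endApp_mapLin, ← hu, mapLin_inc_psi, ← hm]
  rw [← hg]
  rfl

theorem isSquareZeroExtension_incl : IsSquareZeroExtension S.incl S.regularProj where
  injective := S.incl_injective
  exact f := ⟨fun h => S.exists_incl_eq f h, by rintro ⟨m, rfl⟩; exact S.regularProj_incl m⟩
  surjective r := ⟨_, S.regularProj_regularSection r⟩
  right_mul m f := S.incl_mul m f
  left_mul m f := S.mul_incl m f
  sq_zero m m' := by rw [incl_mul, regularProj_incl, zero_smul, map_zero]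

end Splitting

end RegularEnd

end CyclicPower

theorem mainTheorem4 (p : ℕ) [Fact p.Prime] (R : Type*) [CommRing R] (hR : (p : R) = 0) :
    -- the Frobenius pullback of the trace complex is an elementary extension of `R` by `R^{(1)}`
    (CyclicPower.cyclicExtension hR).IsElementaryExtension ∧
    -- `W₂(R)` is a square-zero extension of `R` by `R^{(1)}`
    CyclicPower.IsSquareZeroExtension (CyclicPower.wittIncl hR) (CyclicPower.wittProj p R) ∧
    -- the associated extension of functors to abelian groups admits a splitting
    Nonempty (CyclicPower.Splitting (CyclicPower.cyclicExtension hR)) ∧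
    -- for any splitting, the ring of regular endomorphisms is a square-zero extension of `R` by
    -- `R^{(1)}`, isomorphic to `W₂(R)` as a square-zero extension
    ∀ S : CyclicPower.Splitting (CyclicPower.cyclicExtension hR),
      ∃ q : S.regularEnd →+* R,
        (∀ f : S.regularEnd, S.IsRegularWith (q f) f) ∧
        CyclicPower.IsSquareZeroExtension S.incl q ∧
        ∃ e : S.regularEnd ≃+* TruncatedWittVector p 2 R,
          (∀ m : CyclicPower.Twist hR R, e (S.incl m) = CyclicPower.wittIncl hR m) ∧
          ∀ f : S.regularEnd, CyclicPower.wittProj p R (e f) = q f := by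
  refine ⟨CyclicPower.isElementaryExtension_cyclicExtension hR,
    CyclicPower.isSquareZeroExtension_witt hR, ⟨CyclicPower.wittSplitting hR⟩, fun S =>
    ⟨S.regularProj, S.isRegularWith_scalar, S.isSquareZeroExtension_incl, ?_⟩⟩
  -- Both multiplicative sections, `r ↦ C₀₁(r · id)` and `r ↦ (r, 0)`, have the additive defect
  -- `powDefect p r s`.
  exact S.isSquareZeroExtension_incl.exists_ringEquiv
    (CyclicPower.isSquareZeroExtension_witt hR) S.regularSection (CyclicPower.wittSection p R)
    S.regularProj_regularSection CyclicPower.wittProj_wittSection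
    (fun r s => CyclicPower.toTwist hR R (CyclicPower.powDefect p r s))
    S.regularSection_add (CyclicPower.wittSection_add hR)
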